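/- **Definitions.** Let $H$ be a complex Hilbert space, with inner product $(\cdot,\cdot)_H$ linear in the first variable. A *degenerate semigroup* on $H$ is a map $S\colon(0,\infty)\to\mathcal L(H)$, $t\mapsto S_t$, which is strongly continuous on $(0,\infty)$, satisfies $S_{t+s}=S_tS_s$ for all $t,s>0$, and satisfies $\sup_{t\in(0,1)}\|S_t\|<\infty$. Let $A\subseteq H\times H$ be a graph (linear relation). The degenerate semigroup $S$ is *generated by* $-A$ if there is an $\omega\in\mathbb R$ such that for all real $\lambda>\omega$ the graph $\lambda I+A=\{(x,\lambda x+y):(x,y)\in A\}$ is boundedly invertible, that is, $\{(f,x):(x,f)\in\lambda I+A\}$ is the graph of a bounded everywhere defined operator $(\lambda I+A)^{-1}$ on $H$, and $(\lambda I+A)^{-1}x=\int_0^\infty e^{-\lambda t}S_tx\,dt$ for all $x\in H$, where the integral converges absolutely. Let $V$ be a complex vector space embedded in $H$ and let $\mathfrak a\colon V\times V\to\mathbb C$ be sesquilinear (linear in the first, antilinear in the second variable). For $\theta\in(0,\frac\pi2)$ let $\Sigma_\theta=\{z\in\mathbb C\setminus\{0\}:|\arg z|<\theta\}$. A number $\gamma\in\mathbb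 R$ is a *vertex* of $\mathfrak a$ if there is a $\theta\in(0,\frac\pi2)$ such that $\mathfrak a(u,u)-\gamma\|u\|_H^2\in\overline{\Sigma_\theta}$ for all $u\in V$. The form $\mathfrak a$ is *sectorial* if it has a vertex. A sectorial form is *closed* if there are a vertex $\gamma$ of $\mathfrak a$ and a real $\omega>-\gamma$ such that $$(u,v)\mapsto\tfrac12\bigl(\mathfrak a(u,v)+\overline{\mathfrak a(v,u)}\bigr)+\omega\,(u,v)_H$$ is a complete inner product on $V$. The *graph associated with* $\mathfrak a$ is $$\{(u,f)\in H\times H: u\in V\text{ and }\mathfrak a(u,v)=(f,v)_H\text{ for all }v\in V\}.$$ **Theorem 3.7.** Let $V$ and $H$ be complex Hilbert spaces such that $V$ is continuously embedded in $H$ (not necessarily densely). Let $\mathfrak a\colon V\times V\to\mathbb C$ be a closed, sectorial, sesquilinear form, and let $A$ be the graph in $H$ associated with $\mathfrak a$. Let $(V_n)_{n\in\mathbb N}$ be an increasing sequence of closed subspaces of $V$ such that $\bigcup_{n\in\mathbb N}V_n$ is dense in $V$. For all $n\in\mathbb N$ let $\mathfrak a_n=\mathfrak a|_{V_n\times V_n}$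 and let $A_n$ be the graph in $H$ associated with $\mathfrak a_n$. Then $-A$ and all the $-A_n$ generate degenerate semigroups on $H$, and if $S$ and $S^{(n)}$ are the degenerate semigroups generated by $-A$ and $-A_n$, respectively, then $$\lim_{n\to\infty}\ \sup_{t\in(0,T]}\|(S^{(n)}_t-S_t)f\|_H=0$$ for every $T>0$ and every $f\in H$. -/

import Mathlib

open Filter Topology MeasureTheory
open scoped ComplexConjugate

/-! ### Degenerate semigroups and graphs (linear relations) -/

section Semigroups

variable {X : Type*} [NormedAddCommGroup X] [NormedSpace ℂ X]

/-- A degenerate semigroup `S : (0,∞) → L(X)`: strongly continuous on the open half line, with the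
semigroup law, and bounded on `(0,1)`. Only the values `S t` with `0 < t` matter. -/
structure IsDegenerateSemigroup (S : ℝ → X →L[ℂ] X) : Prop where
  strongly_continuous : ∀ x : X, ContinuousOn (fun t : ℝ => S t x) (Set.Ioi 0)
  semigroup_law : ∀ t s : ℝ, 0 < t → 0 < s → S (t + s) = (S t).comp (S s)
  bounded : ∃ C : ℝ, ∀ t ∈ Set.Ioo (0 : ℝ) 1, ‖S t‖ ≤ C

/-- The graph `c I + A = {(x, c x + y) : (x, y) ∈ A}`. -/
def shiftedGraph (c : ℂ) (A : Submodule ℂ (X × X)) : Set (X × X) :=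
  {p | ∃ x y : X, (x, y) ∈ A ∧ p = (x, c • x + y)}

/-- The graph `B` is boundedly invertible with inverse the bounded operator `R`, that is,
`B⁻¹ = {(f, x) : (x, f) ∈ B}` is the graph of the everywhere defined operator `R`. -/
def HasBoundedInverse (B : Set (X × X)) (R : X →L[ℂ] X) : Prop :=
  ∀ x f : X, (x, f) ∈ B ↔ R f = x

/-- `S` is a degenerate semigroup and `-A` is its generator: for all large real `l` the graph
`l I + A` is boundedly invertible, and its inverse is the (convergent) Laplace integral of `S`. -/
def IsSemigroupGeneratedByNeg (A : Submodule ℂ (X × X)) (S : ℝ → X →L[ℂ] X) : Prop :=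
  IsDegenerateSemigroup S ∧
    ∃ ω : ℝ, ∀ l : ℝ, ω < l →
      ∃ R : X →L[ℂ] X, HasBoundedInverse (shiftedGraph (l : ℂ) A) R ∧
        ∀ x : X,
          IntegrableOn (fun t : ℝ => Real.exp (-(l * t)) • S t x) (Set.Ioi 0) ∧
            R x = ∫ t in Set.Ioi (0 : ℝ), Real.exp (-(l * t)) • S t x

end Semigroups

/-! ### Sectorial forms

A form is a sesquilinear map `a : V × V → ℂ`, linear in the first and antilinear in the second
variable, on a space `V` which is embedded into `H` by `j`. Mathlib's `inner ℂ y x` is linear in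
`x`, so that `(x, y)_H` is `inner ℂ y x`. -/

/-- The open sector `Σ_θ = {z ≠ 0 : |arg z| < θ}`. -/
def openSector (θ : ℝ) : Set ℂ := {z | z ≠ 0 ∧ |z.arg| < θ}

section Forms

variable {V : Type*} [AddCommGroup V] [Module ℂ V]
variable {H : Type*} [NormedAddCommGroup H] [InnerProductSpace ℂ H]

/-- `γ` is a vertex of `a`: there is `θ ∈ (0, π/2)` such that `a(u) - γ ‖u‖_H²` lies in the closed
sector of semiangle `θ` for all `u`. -/
def IsVertex (j : V →ₗ[ℂ] H) (a : V →ₗ[ℂ] V →ₗ⋆[ℂ] ℂ) (γ : ℝ) : Prop :=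
  ∃ θ ∈ Set.Ioo 0 (Real.pi / 2), ∀ u : V,
    a u u - ((γ * ‖j u‖ ^ 2 : ℝ) : ℂ) ∈ closure (openSector θ)

/-- Sectorial forms. -/
def IsSectorialForm (j : V →ₗ[ℂ] H) (a : V →ₗ[ℂ] V →ₗ⋆[ℂ] ℂ) : Prop :=
  ∃ γ : ℝ, IsVertex j a γ

/-- The real part `(u, v) ↦ (a(u, v) + conj (a(v, u))) / 2`. -/
noncomputable def formRealPart (a : V →ₗ[ℂ] V →ₗ⋆[ℂ] ℂ) (u v : V) : ℂ :=
  (1 / 2 : ℂ) * (a u v + conj (a v u))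

/-- `b` is a complete inner product on `V` (linear in the first variable): completeness says that
the sequences which are Cauchy for the norm `u ↦ √(b(u, u))` converge for this norm. -/
structure IsCompleteInnerProduct (b : V → V → ℂ) : Prop where
  add_left : ∀ u v w : V, b (u + v) w = b u w + b v w
  smul_left : ∀ (c : ℂ) (u v : V), b (c • u) v = c * b u v
  conj_symm : ∀ u v : V, conj (b v u) = b u v
  pos : ∀ u : V, u ≠ 0 → 0 < (b u u).re
  complete : ∀ x : ℕ → V,
    (∀ ε > 0, ∃ N : ℕ, ∀ m ≥ N, ∀ n ≥ N, √(b (x m - x n) (x m - x n)).re < ε) →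
      ∃ u : V, Tendsto (fun n => √(b (x n - u) (x n - u)).re) atTop (𝓝 0)

/-- Closed sectorial forms: `Re a + ω (·,·)_H` is a complete inner product on `V` for some `ω` above
`-γ`, where `γ` is a vertex of `a` (so that this inner product dominates the norm of `H`). -/
def IsClosedForm (j : V →ₗ[ℂ] H) (a : V →ₗ[ℂ] V →ₗ⋆[ℂ] ℂ) : Prop :=
  ∃ γ ω : ℝ, IsVertex j a γ ∧ -γ < ω ∧
    IsCompleteInnerProduct (fun u v : V => formRealPart a u v + (ω : ℂ) * inner ℂ (j v) (j u))

/-- The graph in `H` associated with `a`: all `(u, f)` with `u` in (the image of) `V` and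
`a(u, v) = (f, v)_H` for all `v ∈ V`. -/
def associatedGraph (j : V →ₗ[ℂ] H) (a : V →ₗ[ℂ] V →ₗ⋆[ℂ] ℂ) : Submodule ℂ (H × H) where
  carrier := {p | ∃ u : V, j u = p.1 ∧ ∀ v : V, a u v = inner ℂ (j v) p.2}
  zero_mem' := ⟨0, by simp, by simp⟩
  add_mem' := by
    rintro p q ⟨u, hu, hp⟩ ⟨w, hw, hq⟩
    exact ⟨u + w, by simp [hu, hw], fun v => by simp [hp v, hq v]⟩
  smul_mem' := by
    rintro c p ⟨u, hu, hp⟩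
    exact ⟨c • u, by simp [hu], fun v => by simp [hp v]⟩

/-- The restriction of `a` to `W × W`. -/
def restrictForm (a : V →ₗ[ℂ] V →ₗ⋆[ℂ] ℂ) (W : Submodule ℂ V) : W →ₗ[ℂ] W →ₗ⋆[ℂ] ℂ :=
  LinearMap.domRestrict₁₂ a W W

end Forms

/-!
After adding a multiple of `(j u, j v)_H` the form is coercive on `V`, so by Lax–Milgram the
resolvents of the associated graph exist and form a contractive pseudo-resolvent `Q`. The sum of the
range and the kernel of `Q m` is dense, and the limit of the Yosida approximations
`exp (t l (l Q_l - 1))`, which exists on the range and is `0` on the kernel, is a degenerate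
semigroup with Laplace transform `Q`. Céa's lemma shows that the resolvents of the restricted forms
converge strongly to `Q`. As in the Trotter–Kato theorem, this gives convergence of the semigroups
on the range of `(Q m)²`, with uniformity down to `t = 0`; on the kernel of `Q m`, which is the
kernel of the adjoint of `j`, all the semigroups vanish. Finally a semigroup is determined by its
generator, by uniqueness of Laplace transforms.
-/

section UniformConvergence

theorem tendsto_iSup_enorm_sub_of_tendstoUniformlyOn {ι β E : Type*} [SeminormedAddCommGroup E]
    {p : Filter ι} {F : ι → β → E} {f : β → E} {s : Set β} (h : TendstoUniformlyOn F f p s) :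
    Tendsto (fun i => ⨆ b ∈ s, ‖F i b - f b‖ₑ) p (𝓝 0) := by
  refine ENNReal.tendsto_nhds_zero.2 fun ε hε => ?_
  filter_upwards [EMetric.tendstoUniformlyOn_iff.1 h ε hε] with i hi
  refine iSup₂_le fun b hb => ?_
  rw [← edist_eq_enorm_sub, edist_comm]
  exact (hi b hb).le

theorem tendstoUniformlyOn_of_equicontinuousOn {ι X α : Type*} [TopologicalSpace X]
    [UniformSpace α] {p : Filter ι} {F : ι → X → α} {f : X → α} {K : Set X} (hK : IsCompact K)
    (hF : EquicontinuousOn F K) (h : ∀ x ∈ K, Tendsto (fun i => F i x) p (𝓝 (f x))) :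
    TendstoUniformlyOn F f p K := by
  have key := (EquicontinuousOn.tendsto_uniformOnFun_iff_pi' (𝔖 := {K}) (by simpa using hK)
    (by simpa using hF) p f).2 (tendsto_pi_nhds.2 fun x => h x (by simpa using x.2))
  exact UniformOnFun.tendsto_iff_tendstoUniformlyOn.1 key K rfl

theorem tendstoUniformlyOn_zero_of_norm_le {κ β E : Type*} [SeminormedAddCommGroup E]
    {q : Filter κ} {F : κ → β → E} {s : Set β} {g : κ → ℝ}
    (hF : ∀ᶠ k in q, ∀ b ∈ s, ‖F k b‖ ≤ g k) (hg : Tendsto g q (𝓝 0)) :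
    TendstoUniformlyOn F 0 q s := by
  refine Metric.tendstoUniformlyOn_iff.2 fun ε hε => ?_
  filter_upwards [hF, hg.eventually_lt_const hε] with k hk hgk b hb
  simpa using (hk b hb).trans_lt hgk

theorem tendstoUniformlyOn_smul_of_norm_le {𝕜 ι β E : Type*} [NormedField 𝕜]
    [SeminormedAddCommGroup E] [NormedSpace 𝕜 E] {p : Filter ι} {F : ι → β → E} {f : β → E}
    {s : Set β} {c : β → 𝕜} {C : ℝ} (hc : ∀ b ∈ s, ‖c b‖ ≤ C) (h : TendstoUniformlyOn F f p s) :
    TendstoUniformlyOn (fun i b => c b • F i b) (fun b => c b • f b) p s := by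
  refine Metric.tendstoUniformlyOn_iff.2 fun ε hε => ?_
  filter_upwards [Metric.tendstoUniformlyOn_iff.1 h (ε / (|C| + 1)) (by positivity)] with i hi b hb
  calc dist (c b • f b) (c b • F i b) = ‖c b‖ * dist (f b) (F i b) := dist_smul₀ _ _ _
    _ ≤ |C| * dist (f b) (F i b) := by
        gcongr
        exact (hc b hb).trans (le_abs_self C)
    _ ≤ (|C| + 1) * dist (f b) (F i b) := by gcongr; linarith
    _ < ε := (lt_div_iff₀' (by positivity)).1 (hi b hb)

variable {𝕜 X Y : Type*} [NontriviallyNormedField 𝕜] [SeminormedAddCommGroup X] [NormedSpace 𝕜 X]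
  [SeminormedAddCommGroup Y] [NormedSpace 𝕜 Y]

theorem tendstoUniformlyOn_zero_of_dense {κ β : Type*} {q : Filter κ} {D : κ → β → X →L[𝕜] Y}
    {s : Set β} {C : ℝ} (hD : ∀ᶠ k in q, ∀ b ∈ s, ‖D k b‖ ≤ C) {S : Set X} (hS : Dense S)
    (h : ∀ x ∈ S, TendstoUniformlyOn (fun k b => D k b x) 0 q s) (x : X) :
    TendstoUniformlyOn (fun k b => D k b x) 0 q s := by
  refine Metric.tendstoUniformlyOn_iff.2 fun ε hε => ?_
  obtain ⟨y, hyS, hy⟩ : ∃ y ∈ S, dist x y < ε / 2 / (|C| + 1) :=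
    hS.exists_dist_lt x (by positivity)
  filter_upwards [hD, Metric.tendstoUniformlyOn_iff.1 (h y hyS) (ε / 2) (half_pos hε)]
    with k hk hky b hb
  have hxy : ‖D k b (x - y)‖ ≤ ε / 2 := by
    rw [dist_eq_norm] at hy
    calc ‖D k b (x - y)‖ ≤ (|C| + 1) * ‖x - y‖ :=
          (D k b).le_of_opNorm_le ((hk b hb).trans ((le_abs_self C).trans (by simp))) _
      _ ≤ (|C| + 1) * (ε / 2 / (|C| + 1)) := by gcongr
      _ = ε / 2 := by field_simp
  have hy' : ‖D k b y‖ < ε / 2 := by simpa using hky b hb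
  calc dist ((0 : β → Y) b) (D k b x) = ‖D k b (x - y) + D k b y‖ := by simp
    _ ≤ ‖D k b (x - y)‖ + ‖D k b y‖ := norm_add_le _ _
    _ < ε := by linarith

end UniformConvergence

section OperatorExponential

open NormedSpace (exp)

section BanachAlgebra

variable {𝔸 : Type*} [NormedRing 𝔸] [NormedAlgebra ℝ 𝔸] [CompleteSpace 𝔸]

theorem exp_add_smul (a : 𝔸) (t s : ℝ) : exp ((t + s) • a) = exp (t • a) * exp (s • a) := by
  let : NormedAlgebra ℚ 𝔸 := NormedAlgebra.restrictScalars ℚ ℝ 𝔸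
  rw [add_smul]
  exact NormedSpace.exp_add_of_commute (((Commute.refl a).smul_left t).smul_right s)

theorem norm_exp_le_exp_norm [NormOneClass 𝔸] (a : 𝔸) : ‖exp a‖ ≤ Real.exp ‖a‖ := by
  have hexp := NormedSpace.exp_series_hasSum_exp' (𝕂 := ℝ) ‖a‖
  rw [← Real.exp_eq_exp_ℝ] at hexp
  rw [← (NormedSpace.exp_series_hasSum_exp' (𝕂 := ℝ) a).tsum_eq]
  refine tsum_of_norm_bounded hexp fun n => ?_
  rw [norm_smul, smul_eq_mul, Real.norm_of_nonneg (by positivity)]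
  gcongr
  exact norm_pow_le a n

theorem norm_exp_smul_sub_one_le [NormOneClass 𝔸] {a : 𝔸} (ha : ‖a‖ ≤ 1) {c : ℝ} (hc : 0 ≤ c) :
    ‖exp (c • (a - 1))‖ ≤ 1 := by
  let : NormedAlgebra ℚ 𝔸 := NormedAlgebra.restrictScalars ℚ ℝ 𝔸
  have hexp : exp (c • (a - 1)) = Real.exp (-c) • exp (c • a) := by
    have hone : exp (algebraMap ℝ 𝔸 (-c)) = algebraMap ℝ 𝔸 (Real.exp (-c)) := by
      rw [Real.exp_eq_exp_ℝ, NormedSpace.algebraMap_exp_comm]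
    rw [Algebra.smul_def (Real.exp (-c)), ← hone,
      ← NormedSpace.exp_add_of_commute (Algebra.commutes (-c) (c • a)),
      Algebra.algebraMap_eq_smul_one]
    congr 1
    module
  have hnorm : ‖c • a‖ ≤ c := by
    rw [norm_smul, Real.norm_of_nonneg hc]
    exact mul_le_of_le_one_right hc ha
  calc ‖exp (c • (a - 1))‖ = Real.exp (-c) * ‖exp (c • a)‖ := by
        rw [hexp, norm_smul, Real.norm_of_nonneg (Real.exp_nonneg _)]
    _ ≤ Real.exp (-c) * Real.exp c := by
        gcongr
        exact (norm_exp_le_exp_norm _).trans (Real.exp_le_exp.2 hnorm)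
    _ = 1 := by rw [← Real.exp_add, neg_add_cancel, Real.exp_zero]

end BanachAlgebra

variable {X : Type*} [NormedAddCommGroup X] [NormedSpace ℂ X]

theorem exp_smul_apply_comm (A : X →L[ℂ] X) (x : X) (t : ℝ) :
    exp (t • A) (A x) = A (exp (t • A) x) :=
  DFunLike.congr_fun (((Commute.refl A).smul_left t).exp_left).eq x

variable [CompleteSpace X]

theorem exp_apply_of_apply_eq_smul {A : X →L[ℂ] X} {c : ℝ} {x : X} (h : A x = c • x) :
    exp A x = Real.exp c • x := by
  have hpow : ∀ n : ℕ, (A ^ n) x = c ^ n • x := by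
    intro n
    induction n with
    | zero => simp
    | succ n ih =>
      rw [pow_succ, mul_apply_eq_comp, h, (A ^ n).map_smul_of_tower, ih, smul_smul, pow_succ']
  have hA : HasSum (fun n : ℕ => ((n.factorial : ℝ)⁻¹ • A ^ n) x) (exp A x) :=
    (NormedSpace.exp_series_hasSum_exp' (𝕂 := ℝ) A).mapL (ContinuousLinearMap.apply ℂ X x)
  have hc := (NormedSpace.exp_series_hasSum_exp' (𝕂 := ℝ) c).smul_const x
  rw [← Real.exp_eq_exp_ℝ] at hc
  refine hA.unique (hc.congr_fun fun n => ?_)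
  simp only [smul_apply, hpow, smul_smul, smul_eq_mul]

theorem hasDerivAt_exp_smul_apply (A : X →L[ℂ] X) (x : X) (t : ℝ) :
    HasDerivAt (fun s : ℝ => exp (s • A) x) (exp (t • A) (A x)) t :=
  ((ContinuousLinearMap.apply ℂ X x).restrictScalars ℝ).hasFDerivAt.comp_hasDerivAt t
    (hasDerivAt_exp_smul_const (𝕂 := ℝ) A t)

theorem continuous_exp_smul_apply (A : X →L[ℂ] X) (x : X) :
    Continuous fun t : ℝ => exp (t • A) x :=
  continuous_iff_continuousAt.2 fun t => (hasDerivAt_exp_smul_apply A x t).continuousAt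

theorem norm_exp_smul_sub_exp_smul_le {A B : X →L[ℂ] X} {t C : ℝ} (ht : 0 ≤ t)
    (hA : ∀ s ∈ Set.Icc 0 t, ‖exp (s • A)‖ ≤ 1) {x : X}
    (hC : ∀ s ∈ Set.Icc 0 t, ‖(A - B) (exp (s • B) x)‖ ≤ C) :
    ‖exp (t • A) x - exp (t • B) x‖ ≤ t * C := by
  -- Duhamel: differentiate the interpolation between the two sides.
  have hderiv : ∀ s : ℝ, HasDerivAt (fun s : ℝ => exp ((t - s) • A) (exp (s • B) x))
      (-(exp ((t - s) • A) ((A - B) (exp (s • B) x)))) s := by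
    intro s
    have hexpA : HasDerivAt (fun s : ℝ => exp ((t - s) • A)) (-(exp ((t - s) • A) * A)) s := by
      have h := (hasDerivAt_exp_smul_const (𝕂 := ℝ) A (t - s)).scomp s
        ((hasDerivAt_id s).const_sub t)
      rwa [neg_one_smul] at h
    have h := ((ContinuousLinearMap.restrictScalarsL ℂ X X ℝ ℝ).hasFDerivAt.comp_hasDerivAt s
      hexpA).clm_apply (hasDerivAt_exp_smul_apply B x s)
    refine h.congr_deriv ?_
    simp [exp_smul_apply_comm B, sub_eq_add_neg, add_comm]
  have hnorm : ∀ s ∈ Set.Ico 0 t, ‖-(exp ((t - s) • A) ((A - B) (exp (s • B) x)))‖ ≤ C := by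
    intro s hs
    rw [norm_neg]
    exact ((exp ((t - s) • A)).le_of_opNorm_le (hA _ ⟨by linarith [hs.2], by linarith [hs.1]⟩)
      _).trans (by simpa using hC s ⟨hs.1, hs.2.le⟩)
  have := norm_image_sub_le_of_norm_deriv_le_segment' (fun s _ => (hderiv s).hasDerivWithinAt)
    hnorm t ⟨ht, le_rfl⟩
  simpa [norm_sub_rev, mul_comm] using this

end OperatorExponential

section Pseudoresolvent

open NormedSpace (exp)

variable {X : Type*} [NormedAddCommGroup X] [NormedSpace ℂ X]

/-- Pseudo-resolvents on `(0, ∞)` satisfying the Hille–Yosida bound of contraction semigroups. The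
operators `Q l` need not be injective. Only the values `Q l` with `0 < l` matter. -/
structure IsContractivePseudoresolvent (Q : ℝ → X →L[ℂ] X) : Prop where
  sub_eq : ∀ l m : ℝ, 0 < l → 0 < m → Q l - Q m = (m - l) • (Q l * Q m)
  norm_le : ∀ l : ℝ, 0 < l → ‖Q l‖ ≤ l⁻¹

/-- The Yosida approximation `l² Q l - l` of the generator. -/
noncomputable def yosidaGenerator (Q : ℝ → X →L[ℂ] X) (l : ℝ) : X →L[ℂ] X := l • (l • Q l - 1)

/-- `T` is the limit of the semigroups of the Yosida approximations, strongly and locally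
uniformly on `(0, ∞)`. -/
def IsYosidaLimit (Q T : ℝ → X →L[ℂ] X) : Prop :=
  ∀ x : X, TendstoLocallyUniformlyOn (fun (l t : ℝ) => exp (t • yosidaGenerator Q l) x)
    (fun t => T t x) atTop (Set.Ioi 0)

theorem yosidaGenerator_apply (Q : ℝ → X →L[ℂ] X) (l : ℝ) (x : X) :
    yosidaGenerator Q l x = l ^ 2 • Q l x - l • x := by
  simp only [yosidaGenerator, smul_apply, sub_apply, one_apply_eq_self]
  module

namespace IsContractivePseudoresolvent

variable {Q : ℝ → X →L[ℂ] X}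

theorem sub_apply_eq (hQ : IsContractivePseudoresolvent Q) {l m : ℝ} (hl : 0 < l) (hm : 0 < m)
    (x : X) : Q l x - Q m x = (m - l) • Q l (Q m x) :=
  DFunLike.congr_fun (hQ.sub_eq l m hl hm) x

theorem norm_apply_le (hQ : IsContractivePseudoresolvent Q) {l : ℝ} (hl : 0 < l) (x : X) :
    ‖Q l x‖ ≤ l⁻¹ * ‖x‖ :=
  (Q l).le_of_opNorm_le (hQ.norm_le l hl) x

theorem commute (hQ : IsContractivePseudoresolvent Q) {l m : ℝ} (hl : 0 < l) (hm : 0 < m) :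
    Commute (Q l) (Q m) := by
  rcases eq_or_ne l m with rfl | hlm
  · exact Commute.refl _
  · refine smul_right_injective _ (sub_ne_zero.2 hlm.symm) ?_
    linear_combination (norm := module) -(hQ.sub_eq l m hl hm) - hQ.sub_eq m l hm hl

theorem commute_yosidaGenerator (hQ : IsContractivePseudoresolvent Q) {l m : ℝ} (hl : 0 < l)
    (hm : 0 < m) : Commute (yosidaGenerator Q l) (yosidaGenerator Q m) := by
  have h := ((((hQ.commute hl hm).smul_left l).smul_right m).sub_left
    (Commute.one_left _)).sub_right (Commute.one_right (l • Q l - 1))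
  exact (h.smul_left l).smul_right m

theorem apply_eq_zero (hQ : IsContractivePseudoresolvent Q) {l m : ℝ} (hl : 0 < l) (hm : 0 < m)
    {x : X} (hx : Q m x = 0) : Q l x = 0 := by
  simpa [hx] using hQ.sub_apply_eq hl hm x

theorem continuousAt (hQ : IsContractivePseudoresolvent Q) {m : ℝ} (hm : 0 < m) :
    ContinuousAt Q m := by
  rw [ContinuousAt, tendsto_iff_norm_sub_tendsto_zero]
  have hlim : Tendsto (fun l : ℝ => |m - l| * (l⁻¹ * m⁻¹)) (𝓝 m) (𝓝 0) := by
    have h : ContinuousAt (fun l : ℝ => |m - l| * (l⁻¹ * m⁻¹)) m := by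
      fun_prop (disch := exact hm.ne')
    simpa [ContinuousAt] using h
  refine squeeze_zero' (Eventually.of_forall fun l => norm_nonneg _) ?_ hlim
  filter_upwards [lt_mem_nhds hm] with l hl
  rw [hQ.sub_eq l m hl hm, norm_smul, Real.norm_eq_abs]
  gcongr
  exact norm_mul_le_of_le (hQ.norm_le l hl) (hQ.norm_le m hm)

theorem smul_apply_sub (hQ : IsContractivePseudoresolvent Q) {l m : ℝ} (hl : 0 < l) (hm : 0 < m)
    (x : X) : l • Q l (Q m x) - Q m x = Q l (m • Q m x - x) := by
  rw [map_sub, (Q l).map_smul_of_tower]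
  linear_combination (norm := module) hQ.sub_apply_eq hl hm x

theorem norm_smul_apply_sub_le (hQ : IsContractivePseudoresolvent Q) {m : ℝ} (hm : 0 < m) (x : X) :
    ‖m • Q m x - x‖ ≤ 2 * ‖x‖ := by
  have h : ‖m • Q m x‖ ≤ ‖x‖ := by
    rw [norm_smul, Real.norm_of_nonneg hm.le, ← le_inv_mul_iff₀ hm]
    exact hQ.norm_apply_le hm x
  linarith [norm_sub_le (m • Q m x) x]

/-- On the range of `(Q m)²` the Yosida approximations converge with rate `l⁻¹`. -/
theorem norm_yosidaGenerator_apply_sub_le (hQ : IsContractivePseudoresolvent Q) {l m : ℝ}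
    (hl : 0 < l) (hm : 0 < m) (x : X) :
    ‖yosidaGenerator Q l (Q m (Q m x)) - Q m (m • Q m x - x)‖ ≤ 4 * l⁻¹ * ‖x‖ := by
  have hgen : ∀ y, yosidaGenerator Q l (Q m y) = l • Q l (m • Q m y - y) := fun y => by
    rw [← hQ.smul_apply_sub hl hm, yosidaGenerator_apply]
    module
  have hcomm : m • Q m (Q m x) - Q m x = Q m (m • Q m x - x) := by
    rw [map_sub, (Q m).map_smul_of_tower]
  rw [hgen, hcomm, hQ.smul_apply_sub hl hm]
  calc ‖Q l (m • Q m (m • Q m x - x) - (m • Q m x - x))‖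
      ≤ l⁻¹ * ‖m • Q m (m • Q m x - x) - (m • Q m x - x)‖ := hQ.norm_apply_le hl _
    _ ≤ l⁻¹ * (2 * (2 * ‖x‖)) := by
        gcongr
        refine (hQ.norm_smul_apply_sub_le hm _).trans ?_
        gcongr
        exact hQ.norm_smul_apply_sub_le hm x
    _ = 4 * l⁻¹ * ‖x‖ := by ring

theorem tendsto_smul_apply_apply (hQ : IsContractivePseudoresolvent Q) {m : ℝ} (hm : 0 < m)
    (x : X) : Tendsto (fun l : ℝ => l • Q l (Q m x)) atTop (𝓝 (Q m x)) := by
  refine tendsto_iff_norm_sub_tendsto_zero.2 (squeeze_zero' (Eventually.of_forall fun l =>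
    norm_nonneg _) ((eventually_gt_atTop 0).mono fun l hl => ?_)
    (by simpa using tendsto_inv_atTop_zero.mul_const ‖m • Q m x - x‖))
  rw [hQ.smul_apply_sub hl hm]
  exact hQ.norm_apply_le hl _

theorem dense_range_sq_sup_ker (hQ : IsContractivePseudoresolvent Q) {m : ℝ} (hm : 0 < m)
    (hdense : Dense (((Q m).range ⊔ (Q m).ker : Submodule ℂ X) : Set X)) :
    Dense (((Q m * Q m).range ⊔ (Q m).ker : Submodule ℂ X) : Set X) := by
  set D := (Q m * Q m).range ⊔ (Q m).ker
  have hsq : ∀ l, 0 < l → ∀ x, Q l (Q m x) = (Q m * Q m) (x + (m - l) • Q l x) := by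
    intro l hl x
    have hcomm : ∀ y, Q l (Q m y) = Q m (Q l y) := DFunLike.congr_fun (hQ.commute hl hm).eq
    rw [mul_apply_eq_comp, map_add, (Q m).map_smul_of_tower, ← hcomm, ← hQ.sub_apply_eq hl hm,
      add_sub_cancel, hcomm]
  have hmem : ∀ x, Q m x ∈ D.topologicalClosure := fun x =>
    mem_closure_of_tendsto (hQ.tendsto_smul_apply_apply hm x) <|
      (eventually_gt_atTop 0).mono fun l hl => D.smul_of_tower_mem l <|
        le_sup_left (a := (Q m * Q m).range) ⟨_, (hsq l hl x).symm⟩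
  have hle : (Q m).range ⊔ (Q m).ker ≤ D.topologicalClosure :=
    sup_le (by rintro _ ⟨x, rfl⟩; exact hmem x) (le_sup_right.trans D.le_topologicalClosure)
  exact dense_closure.1 (hdense.mono hle)

theorem tendstoUniformlyOn_zero (hQ : IsContractivePseudoresolvent Q) {m : ℝ} (hm : 0 < m)
    (hdense : Dense (((Q m).range ⊔ (Q m).ker : Submodule ℂ X) : Set X)) {κ β : Type*}
    {q : Filter κ} {D : κ → β → X →L[ℂ] X} {s : Set β} {C : ℝ}
    (hD : ∀ᶠ k in q, ∀ b ∈ s, ‖D k b‖ ≤ C)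
    (hrange : ∀ x, TendstoUniformlyOn (fun k b => D k b (Q m (Q m x))) 0 q s)
    (hker : ∀ x, Q m x = 0 → TendstoUniformlyOn (fun k b => D k b x) 0 q s) (x : X) :
    TendstoUniformlyOn (fun k b => D k b x) 0 q s := by
  refine tendstoUniformlyOn_zero_of_dense hD (hQ.dense_range_sq_sup_ker hm hdense) ?_ x
  intro y hy
  obtain ⟨_, ⟨u, rfl⟩, v, hv, rfl⟩ := Submodule.mem_sup.1 hy
  have h := (hrange u).add (hker v hv)
  rw [add_zero] at h
  exact h.congr (Eventually.of_forall fun k b _ => (map_add (D k b) _ _).symm)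

variable [CompleteSpace X]

theorem norm_exp_yosidaGenerator_le (hQ : IsContractivePseudoresolvent Q) {l t : ℝ} (hl : 0 < l)
    (ht : 0 ≤ t) : ‖exp (t • yosidaGenerator Q l)‖ ≤ 1 := by
  rcases subsingleton_or_nontrivial X with _ | _
  · rw [Subsingleton.elim (exp _) 0, norm_zero]
    exact zero_le_one
  · have h : ‖l • Q l‖ ≤ 1 := by
      rw [norm_smul, Real.norm_of_nonneg hl.le, ← le_inv_mul_iff₀ hl, mul_one]
      exact hQ.norm_le l hl
    rw [yosidaGenerator, smul_smul]
    exact norm_exp_smul_sub_one_le h (by positivity)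

theorem exp_yosidaGenerator_apply_of_ker (hQ : IsContractivePseudoresolvent Q) {l m : ℝ}
    (hl : 0 < l) (hm : 0 < m) (t : ℝ) {x : X} (hx : Q m x = 0) :
    exp (t • yosidaGenerator Q l) x = Real.exp (-(t * l)) • x := by
  refine exp_apply_of_apply_eq_smul ?_
  rw [smul_apply, yosidaGenerator_apply, hQ.apply_eq_zero hl hm hx]
  module

theorem norm_exp_yosidaGenerator_sub_le (hQ : IsContractivePseudoresolvent Q) {k l m t : ℝ}
    (hk : 0 < k) (hl : 0 < l) (hm : 0 < m) (ht : 0 ≤ t) (x : X) :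
    ‖exp (t • yosidaGenerator Q k) (Q m (Q m x)) - exp (t • yosidaGenerator Q l) (Q m (Q m x))‖ ≤
      t * ((4 * k⁻¹ + 4 * l⁻¹) * ‖x‖) := by
  set A := yosidaGenerator Q k
  set B := yosidaGenerator Q l
  refine norm_exp_smul_sub_exp_smul_le ht
    (fun s hs => hQ.norm_exp_yosidaGenerator_le hk hs.1) fun s hs => ?_
  have hcomm : (A - B) (exp (s • B) (Q m (Q m x))) = exp (s • B) ((A - B) (Q m (Q m x))) := by
    have h : Commute (A - B) (s • B) :=
      ((hQ.commute_yosidaGenerator hk hl).sub_left (Commute.refl B)).smul_right s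
    exact DFunLike.congr_fun h.exp_right.eq _
  have hAB : ‖(A - B) (Q m (Q m x))‖ ≤ (4 * k⁻¹ + 4 * l⁻¹) * ‖x‖ := by
    rw [sub_apply, ← sub_sub_sub_cancel_right _ _ (Q m (m • Q m x - x)), add_mul]
    exact norm_sub_le_of_le (hQ.norm_yosidaGenerator_apply_sub_le hk hm x)
      (hQ.norm_yosidaGenerator_apply_sub_le hl hm x)
  rw [hcomm]
  exact ((exp (s • B)).le_of_opNorm_le_of_le (hQ.norm_exp_yosidaGenerator_le hl hs.1) hAB).trans_eq
    (one_mul _)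

theorem norm_exp_yosidaGenerator_sub_le_of_ker (hQ : IsContractivePseudoresolvent Q)
    {k l m a t : ℝ} (hk : 0 < k) (hl : 0 < l) (hm : 0 < m) (hat : a ≤ t) {x : X}
    (hx : Q m x = 0) :
    ‖exp (t • yosidaGenerator Q k) x - exp (t • yosidaGenerator Q l) x‖ ≤
      (Real.exp (-(a * k)) + Real.exp (-(a * l))) * ‖x‖ := by
  rw [hQ.exp_yosidaGenerator_apply_of_ker hk hm t hx,
    hQ.exp_yosidaGenerator_apply_of_ker hl hm t hx, add_mul]
  refine norm_sub_le_of_le ?_ ?_ <;> rw [norm_smul, Real.norm_of_nonneg (Real.exp_nonneg _)] <;>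
    gcongr

theorem uniformCauchySeqOn_exp_yosidaGenerator (hQ : IsContractivePseudoresolvent Q) {m : ℝ}
    (hm : 0 < m) (hdense : Dense (((Q m).range ⊔ (Q m).ker : Submodule ℂ X) : Set X)) {a b : ℝ}
    (ha : 0 < a) (x : X) :
    UniformCauchySeqOn (fun (l t : ℝ) => exp (t • yosidaGenerator Q l) x) atTop (Set.Icc a b) := by
  rw [SeminormedAddGroup.uniformCauchySeqOn_iff_tendstoUniformlyOn_zero]
  have hpos : ∀ᶠ k : ℝ × ℝ in atTop ×ˢ atTop, 0 < k.1 ∧ 0 < k.2 :=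
    (eventually_gt_atTop 0).prod_mk (eventually_gt_atTop 0)
  set D : ℝ × ℝ → ℝ → X →L[ℂ] X :=
    fun k t => exp (t • yosidaGenerator Q k.2) - exp (t • yosidaGenerator Q k.1)
  suffices h : TendstoUniformlyOn (fun k t => D k t x) 0 (atTop ×ˢ atTop) (Set.Icc a b) from
    h.congr (Eventually.of_forall fun k t _ => (neg_add_eq_sub _ _).symm)
  refine hQ.tendstoUniformlyOn_zero hm hdense (C := 1 + 1) ?_ (fun y => ?_) (fun y hy => ?_) x
  · filter_upwards [hpos] with k hk t ht
    exact norm_sub_le_of_le (hQ.norm_exp_yosidaGenerator_le hk.2 (ha.le.trans ht.1))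
      (hQ.norm_exp_yosidaGenerator_le hk.1 (ha.le.trans ht.1))
  · refine tendstoUniformlyOn_zero_of_norm_le
      (g := fun k => b * ((4 * k.2⁻¹ + 4 * k.1⁻¹) * ‖y‖)) ?_ ?_
    · filter_upwards [hpos] with k hk t ht
      have := hk.1
      have := hk.2
      refine (hQ.norm_exp_yosidaGenerator_sub_le hk.2 hk.1 hm (ha.le.trans ht.1) y).trans ?_
      gcongr
      exact ht.2
    · simpa using ((((tendsto_inv_atTop_zero.comp tendsto_snd).const_mul 4).add
        ((tendsto_inv_atTop_zero.comp tendsto_fst).const_mul 4)).mul_const ‖y‖).const_mul b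
  · have hexp : Tendsto (fun l : ℝ => Real.exp (-(a * l))) atTop (𝓝 0) :=
      Real.tendsto_exp_neg_atTop_nhds_zero.comp (tendsto_id.const_mul_atTop ha)
    refine tendstoUniformlyOn_zero_of_norm_le
      (g := fun k => (Real.exp (-(a * k.2)) + Real.exp (-(a * k.1))) * ‖y‖) ?_ ?_
    · filter_upwards [hpos] with k ⟨hk₁, hk₂⟩ t ht
      exact hQ.norm_exp_yosidaGenerator_sub_le_of_ker hk₂ hk₁ hm ht.1 hy
    · simpa using ((hexp.comp tendsto_snd).add (hexp.comp tendsto_fst)).mul_const ‖y‖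

theorem exists_isYosidaLimit (hQ : IsContractivePseudoresolvent Q) {m : ℝ} (hm : 0 < m)
    (hdense : Dense (((Q m).range ⊔ (Q m).ker : Submodule ℂ X) : Set X)) :
    ∃ T, IsYosidaLimit Q T := by
  have hcauchy (x : X) {a b : ℝ} (ha : 0 < a) :=
    hQ.uniformCauchySeqOn_exp_yosidaGenerator hm hdense (b := b) ha x
  have hpointwise : ∀ t : ℝ, ∃ Tt : X →L[ℂ] X, 0 < t → ∀ x,
      Tendsto (fun l => exp (t • yosidaGenerator Q l) x) atTop (𝓝 (Tt x)) := by
    intro t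
    by_cases ht : 0 < t
    · choose f hf using fun x =>
        cauchy_map_iff_exists_tendsto.1 ((hcauchy x ht).cauchy_map (Set.left_mem_Icc.2 le_rfl))
      exact ⟨continuousLinearMapOfTendsto _ (tendsto_pi_nhds.2 hf), fun _ => hf⟩
    · exact ⟨0, fun h => absurd h ht⟩
  choose T hT using hpointwise
  refine ⟨T, fun x => tendstoLocallyUniformlyOn_of_forall_exists_nhds fun t ht => ?_⟩
  have ht₂ : t / 2 < t := half_lt_self ht
  exact ⟨Set.Icc (t / 2) (t + 1), mem_nhdsWithin_of_mem_nhds (Icc_mem_nhds ht₂ (lt_add_one t)),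
    (hcauchy x (half_pos ht)).tendstoUniformlyOn_of_tendsto fun s hs =>
      hT s ((half_pos ht).trans_le hs.1) x⟩

end IsContractivePseudoresolvent

end Pseudoresolvent

section YosidaLimit

open NormedSpace (exp)

variable {X : Type*} [NormedAddCommGroup X] [NormedSpace ℂ X]

variable {Q T : ℝ → X →L[ℂ] X}

theorem IsYosidaLimit.tendsto (hT : IsYosidaLimit Q T) {t : ℝ} (ht : 0 < t) (x : X) :
    Tendsto (fun l => exp (t • yosidaGenerator Q l) x) atTop (𝓝 (T t x)) :=
  (hT x).tendsto_at ht

theorem IsContractivePseudoresolvent.smul_sub_yosidaGenerator_apply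
    (hQ : IsContractivePseudoresolvent Q) {l m : ℝ} (hl : 0 < l) (hm : 0 < m) (x : X) :
    let y := (l + m)⁻¹ • x + (l / (l + m)) ^ 2 • Q (m * l / (l + m)) x
    m • y - yosidaGenerator Q l y = x := by
  intro y
  have hlm : l + m ≠ 0 := (add_pos hl hm).ne'
  have hres := hQ.sub_apply_eq hl (div_pos (mul_pos hm hl) (add_pos hl hm)) x
  rw [show m * l / (l + m) - l = -(l ^ 2 / (l + m)) by field_simp; ring] at hres
  simp only [y, yosidaGenerator_apply, _root_.map_add, (Q l).map_smul_of_tower]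
  linear_combination (norm := skip) (-(l ^ 2 / (l + m))) • hres
  match_scalars <;> field_simp <;> ring

theorem IsContractivePseudoresolvent.tendsto_add_smul_apply
    (hQ : IsContractivePseudoresolvent Q) {m : ℝ} (hm : 0 < m) (x : X) :
    Tendsto (fun l : ℝ => (l + m)⁻¹ • x + (l / (l + m)) ^ 2 • Q (m * l / (l + m)) x) atTop
      (𝓝 (Q m x)) := by
  have hinv : Tendsto (fun l : ℝ => (l + m)⁻¹) atTop (𝓝 0) :=
    tendsto_inv_atTop_zero.comp (tendsto_atTop_add_const_right _ m tendsto_id)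
  have hratio : Tendsto (fun l : ℝ => l / (l + m)) atTop (𝓝 1) := by
    have h : Tendsto (fun l : ℝ => 1 - m * (l + m)⁻¹) atTop (𝓝 1) := by
      simpa using (hinv.const_mul m).const_sub 1
    refine h.congr' ((eventually_gt_atTop 0).mono fun l hl => ?_)
    have : l + m ≠ 0 := (add_pos hl hm).ne'
    field_simp
    ring
  have harg : Tendsto (fun l : ℝ => m * l / (l + m)) atTop (𝓝 m) := by
    simpa [mul_div_assoc] using hratio.const_mul m
  have hQm : Tendsto (fun l : ℝ => Q (m * l / (l + m)) x) atTop (𝓝 (Q m x)) :=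
    ((ContinuousLinearMap.apply ℂ X x).continuous.continuousAt.comp
      (hQ.continuousAt hm)).tendsto.comp harg
  simpa using (hinv.smul_const x).add ((hratio.pow 2).smul hQm)

variable [CompleteSpace X]

theorem integral_exp_neg_mul_smul_exp_smul_apply {B : X →L[ℂ] X}
    (hB : ∀ t : ℝ, 0 ≤ t → ‖exp (t • B)‖ ≤ 1) {m : ℝ} (hm : 0 < m) (x : X) :
    ∫ t in Set.Ioi (0 : ℝ), Real.exp (-(m * t)) • exp (t • B) (m • x - B x) = x := by
  have hderiv : ∀ t : ℝ, HasDerivAt (fun t : ℝ => -(Real.exp (-(m * t)) • exp (t • B) x))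
      (Real.exp (-(m * t)) • exp (t • B) (m • x - B x)) t := by
    intro t
    have hexp : HasDerivAt (fun t : ℝ => Real.exp (-(m * t))) (Real.exp (-(m * t)) * -m) t := by
      simpa using ((hasDerivAt_id t).const_mul m).neg.exp
    refine (hexp.smul (hasDerivAt_exp_smul_apply B x t)).neg.congr_deriv ?_
    rw [map_sub, (exp (t • B)).map_smul_of_tower]
    module
  have hbound : ∀ y, ∀ t : ℝ, 0 ≤ t → ‖Real.exp (-(m * t)) • exp (t • B) y‖ ≤
      Real.exp (-(m * t)) * ‖y‖ := fun y t ht => by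
    rw [norm_smul, Real.norm_of_nonneg (Real.exp_nonneg _)]
    gcongr
    simpa using (exp (t • B)).le_of_opNorm_le (hB t ht) y
  have hlim : Tendsto (fun t : ℝ => -(Real.exp (-(m * t)) • exp (t • B) x)) atTop (𝓝 0) := by
    refine squeeze_zero_norm' (a := fun t => Real.exp (-(m * t)) * ‖x‖) ?_ ?_
    · filter_upwards [eventually_ge_atTop 0] with t ht
      rw [norm_neg]
      exact hbound x t ht
    · simpa using (Real.tendsto_exp_neg_atTop_nhds_zero.comp
        (tendsto_id.const_mul_atTop hm)).mul_const ‖x‖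
  have hint : IntegrableOn (fun t : ℝ => Real.exp (-(m * t)) • exp (t • B) (m • x - B x))
      (Set.Ioi 0) := by
    refine Integrable.mono' (g := fun t => Real.exp (-m * t) * ‖m • x - B x‖)
      ((exp_neg_integrableOn_Ioi 0 hm).mul_const _) ?_ ?_
    · have hcont := continuous_exp_smul_apply B (m • x - B x)
      exact Continuous.aestronglyMeasurable (by fun_prop)
    · filter_upwards [ae_restrict_mem measurableSet_Ioi] with t ht
      rw [neg_mul]
      exact hbound _ t (le_of_lt ht)
  have := integral_Ioi_of_hasDerivAt_of_tendsto' (fun t _ => hderiv t) hint hlim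
  simpa using this

namespace IsYosidaLimit

theorem continuousOn (hT : IsYosidaLimit Q T) (x : X) :
    ContinuousOn (fun t => T t x) (Set.Ioi 0) :=
  (hT x).continuousOn (Frequently.of_forall fun _ =>
    (continuous_exp_smul_apply _ x).continuousOn)

theorem norm_le (hT : IsYosidaLimit Q T) (hQ : IsContractivePseudoresolvent Q) {t : ℝ}
    (ht : 0 < t) : ‖T t‖ ≤ 1 :=
  (T t).opNorm_le_bound zero_le_one fun x => le_of_tendsto (hT.tendsto ht x).norm <|
    (eventually_gt_atTop 0).mono fun _ hl =>
      ContinuousLinearMap.le_of_opNorm_le _ (hQ.norm_exp_yosidaGenerator_le hl ht.le) x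

theorem map_add (hT : IsYosidaLimit Q T) (hQ : IsContractivePseudoresolvent Q) {t s : ℝ}
    (ht : 0 < t) (hs : 0 < s) : T (t + s) = (T t).comp (T s) := by
  ext x
  refine tendsto_nhds_unique (hT.tendsto (add_pos ht hs) x) ?_
  have hdiff : Tendsto (fun l => exp (t • yosidaGenerator Q l)
      (exp (s • yosidaGenerator Q l) x - T s x)) atTop (𝓝 0) := by
    refine squeeze_zero_norm' ((eventually_gt_atTop 0).mono fun l hl =>
      ContinuousLinearMap.le_of_opNorm_le _ (hQ.norm_exp_yosidaGenerator_le hl ht.le) _) ?_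
    simpa using ((hT.tendsto hs x).sub_const (T s x)).norm
  have h := hdiff.add (hT.tendsto ht (T s x))
  rw [zero_add] at h
  refine h.congr fun l => ?_
  rw [exp_add_smul (yosidaGenerator Q l) t s, mul_apply_eq_comp, map_sub, sub_add_cancel]

theorem apply_of_ker (hT : IsYosidaLimit Q T) (hQ : IsContractivePseudoresolvent Q) {t m : ℝ}
    (ht : 0 < t) (hm : 0 < m) {x : X} (hx : Q m x = 0) : T t x = 0 := by
  have hexp : Tendsto (fun l : ℝ => Real.exp (-(t * l))) atTop (𝓝 0) :=
    Real.tendsto_exp_neg_atTop_nhds_zero.comp (tendsto_id.const_mul_atTop ht)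
  refine tendsto_nhds_unique (hT.tendsto ht x)
    ((zero_smul ℝ x ▸ hexp.smul_const x).congr' ?_)
  filter_upwards [eventually_gt_atTop 0] with l hl
  exact (hQ.exp_yosidaGenerator_apply_of_ker hl hm t hx).symm

theorem isDegenerateSemigroup_exp_smul (hT : IsYosidaLimit Q T)
    (hQ : IsContractivePseudoresolvent Q) (w : ℝ) :
    IsDegenerateSemigroup fun t => Real.exp (w * t) • T t where
  strongly_continuous x := by
    have := hT.continuousOn x
    simp only [smul_apply]
    fun_prop
  semigroup_law t s ht hs := by
    rw [hT.map_add hQ ht hs, mul_add, Real.exp_add]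
    ext x
    simp only [smul_apply, ContinuousLinearMap.comp_apply, ContinuousLinearMap.map_smul_of_tower,
      smul_smul]
  bounded := by
    refine ⟨Real.exp |w|, fun t ht => ?_⟩
    have hwt : w * t ≤ |w| := calc
      w * t ≤ |w| * t := mul_le_mul_of_nonneg_right (le_abs_self w) ht.1.le
      _ ≤ |w| := mul_le_of_le_one_right (abs_nonneg w) ht.2.le
    rw [norm_smul, Real.norm_of_nonneg (Real.exp_nonneg _)]
    exact (mul_le_of_le_one_right (Real.exp_nonneg _) (hT.norm_le hQ ht.1)).trans
      (Real.exp_le_exp.2 hwt)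

theorem integrableOn (hT : IsYosidaLimit Q T) (hQ : IsContractivePseudoresolvent Q) {m : ℝ}
    (hm : 0 < m) (x : X) : IntegrableOn (fun t => Real.exp (-(m * t)) • T t x) (Set.Ioi 0) := by
  have hc := hT.continuousOn x
  refine Integrable.mono' (g := fun t => Real.exp (-m * t) * ‖x‖)
    ((exp_neg_integrableOn_Ioi 0 hm).mul_const _)
    (ContinuousOn.aestronglyMeasurable (by fun_prop) measurableSet_Ioi) ?_
  filter_upwards [ae_restrict_mem measurableSet_Ioi] with t ht
  rw [norm_smul, Real.norm_of_nonneg (Real.exp_nonneg _), neg_mul]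
  gcongr
  simpa using (T t).le_of_opNorm_le (hT.norm_le hQ ht) x

theorem integral_exp_neg_mul_smul_apply (hT : IsYosidaLimit Q T)
    (hQ : IsContractivePseudoresolvent Q) {m : ℝ} (hm : 0 < m) (x : X) :
    ∫ t in Set.Ioi (0 : ℝ), Real.exp (-(m * t)) • T t x = Q m x := by
  have hleft : Tendsto (fun l => ∫ t in Set.Ioi (0 : ℝ),
      Real.exp (-(m * t)) • exp (t • yosidaGenerator Q l) x) atTop
      (𝓝 (∫ t in Set.Ioi (0 : ℝ), Real.exp (-(m * t)) • T t x)) := by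
    refine tendsto_integral_filter_of_dominated_convergence (fun t => Real.exp (-m * t) * ‖x‖)
      (Eventually.of_forall fun l => ?_) ?_ ((exp_neg_integrableOn_Ioi 0 hm).mul_const _) ?_
    · have hcont := continuous_exp_smul_apply (yosidaGenerator Q l) x
      exact Continuous.aestronglyMeasurable (by fun_prop)
    · filter_upwards [eventually_gt_atTop 0] with l hl
      filter_upwards [ae_restrict_mem measurableSet_Ioi] with t ht
      rw [norm_smul, Real.norm_of_nonneg (Real.exp_nonneg _), neg_mul]
      gcongr
      simpa using ContinuousLinearMap.le_of_opNorm_le _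
        (hQ.norm_exp_yosidaGenerator_le hl (le_of_lt ht)) x
    · filter_upwards [ae_restrict_mem measurableSet_Ioi] with t ht
      exact (hT.tendsto ht x).const_smul _
  refine tendsto_nhds_unique hleft ((hQ.tendsto_add_smul_apply hm x).congr' ?_)
  filter_upwards [eventually_gt_atTop 0] with l hl
  have h := integral_exp_neg_mul_smul_exp_smul_apply
    (fun t ht => hQ.norm_exp_yosidaGenerator_le hl ht) hm
    ((l + m)⁻¹ • x + (l / (l + m)) ^ 2 • Q (m * l / (l + m)) x)
  rw [hQ.smul_sub_yosidaGenerator_apply hl hm] at h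
  exact h.symm

end IsYosidaLimit

end YosidaLimit

section TrotterKato

open NormedSpace (exp)

variable {X : Type*} [NormedAddCommGroup X] [NormedSpace ℂ X]

theorem IsContractivePseudoresolvent.norm_yosidaGenerator_le {Q : ℝ → X →L[ℂ] X}
    (hQ : IsContractivePseudoresolvent Q) {l : ℝ} (hl : 0 < l) :
    ‖yosidaGenerator Q l‖ ≤ l * 2 := by
  rw [yosidaGenerator, norm_smul, Real.norm_of_nonneg hl.le]
  gcongr
  exact ContinuousLinearMap.opNorm_le_bound _ zero_le_two fun x => hQ.norm_smul_apply_sub_le hl x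

variable {ι : Type*} {p : Filter ι}

theorem IsContractivePseudoresolvent.tendsto_apply_apply {Q : ℝ → X →L[ℂ] X}
    {Q' : ι → ℝ → X →L[ℂ] X} (hQ' : ∀ i, IsContractivePseudoresolvent (Q' i)) {m : ℝ}
    (hm : 0 < m) (hlim : ∀ x, Tendsto (fun i => Q' i m x) p (𝓝 (Q m x))) (x : X) :
    Tendsto (fun i => Q' i m (Q' i m x)) p (𝓝 (Q m (Q m x))) := by
  have hdiff : Tendsto (fun i => Q' i m (Q' i m x - Q m x)) p (𝓝 0) := by
    refine squeeze_zero_norm (fun i => (hQ' i).norm_apply_le hm _) ?_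
    simpa using ((hlim x).sub_const (Q m x)).norm.const_mul m⁻¹
  simpa using hdiff.add (hlim (Q m x))

variable [CompleteSpace X]

theorem tendstoUniformlyOn_exp_smul_apply {A : X →L[ℂ] X} {B : ι → X →L[ℂ] X} {C : ℝ}
    (hexp : ∀ i, ∀ t : ℝ, 0 ≤ t → ‖exp (t • B i)‖ ≤ 1) (hC : ∀ i, ‖B i‖ ≤ C)
    (hB : ∀ x, Tendsto (fun i => B i x) p (𝓝 (A x))) (x : X) (r : ℝ) :
    TendstoUniformlyOn (fun (i : ι) (t : ℝ) => exp (t • B i) x) (fun t => exp (t • A) x) p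
      (Set.Icc 0 r) := by
  have horbit : TendstoUniformlyOn (fun i => ⇑(B i)) A p
      ((fun t : ℝ => exp (t • A) x) '' Set.Icc 0 r) := by
    refine tendstoUniformlyOn_of_equicontinuousOn
      (isCompact_Icc.image (continuous_exp_smul_apply A x)) ?_ fun y _ => hB y
    have hlip : ∀ i, LipschitzWith C.toNNReal (B i) := fun i =>
      (B i).lipschitz.weaken (by rw [← norm_toNNReal]; exact Real.toNNReal_mono (hC i))
    exact (LipschitzWith.uniformEquicontinuous _ _ hlip).equicontinuous.equicontinuousOn _
  refine Metric.tendstoUniformlyOn_iff.2 fun ε hε => ?_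
  filter_upwards [Metric.tendstoUniformlyOn_iff.1 horbit (ε / (|r| + 1)) (by positivity)]
    with i hi t ht
  have hbound : ∀ s ∈ Set.Icc 0 t, ‖(B i - A) (exp (s • A) x)‖ ≤ ε / (|r| + 1) := fun s hs => by
    rw [sub_apply, ← dist_eq_norm, dist_comm]
    exact (hi _ ⟨s, ⟨hs.1, hs.2.trans ht.2⟩, rfl⟩).le
  rw [dist_comm, dist_eq_norm]
  calc ‖exp (t • B i) x - exp (t • A) x‖ ≤ t * (ε / (|r| + 1)) :=
        norm_exp_smul_sub_exp_smul_le ht.1 (fun s hs => hexp i s hs.1) hbound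
    _ < (|r| + 1) * (ε / (|r| + 1)) := by
        gcongr
        exact (ht.2.trans (le_abs_self r)).trans_lt (lt_add_one _)
    _ = ε := by field_simp

namespace IsYosidaLimit

variable {Q Q' T T' : ℝ → X →L[ℂ] X}

theorem norm_apply_sub_exp_yosidaGenerator_le (hT : IsYosidaLimit Q T)
    (hQ : IsContractivePseudoresolvent Q) {l m t : ℝ} (hl : 0 < l) (hm : 0 < m) (ht : 0 < t)
    (x : X) :
    ‖T t (Q m (Q m x)) - exp (t • yosidaGenerator Q l) (Q m (Q m x))‖ ≤ t * (4 * l⁻¹ * ‖x‖) := by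
  have hbound : Tendsto (fun k : ℝ => t * ((4 * k⁻¹ + 4 * l⁻¹) * ‖x‖)) atTop
      (𝓝 (t * (4 * l⁻¹ * ‖x‖))) := by
    simpa using (((tendsto_inv_atTop_zero.const_mul 4).add_const (4 * l⁻¹)).mul_const ‖x‖).const_mul
      t
  refine le_of_tendsto_of_tendsto ((hT.tendsto ht _).sub_const _).norm hbound ?_
  filter_upwards [eventually_gt_atTop 0] with k hk
  exact hQ.norm_exp_yosidaGenerator_sub_le hk hl hm ht.le x

theorem norm_apply_sub_apply_le (hT : IsYosidaLimit Q T) (hQ : IsContractivePseudoresolvent Q)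
    (hT' : IsYosidaLimit Q' T') (hQ' : IsContractivePseudoresolvent Q') {l m t : ℝ} (hl : 0 < l)
    (hm : 0 < m) (ht : 0 < t) (x : X) :
    ‖T' t (Q m (Q m x)) - T t (Q m (Q m x))‖ ≤
      2 * ‖Q' m (Q' m x) - Q m (Q m x)‖ + t * (8 * l⁻¹ * ‖x‖) +
        ‖exp (t • yosidaGenerator Q' l) (Q m (Q m x)) -
          exp (t • yosidaGenerator Q l) (Q m (Q m x))‖ := by
  set y := Q m (Q m x)
  set y' := Q' m (Q' m x)
  set e := exp (t • yosidaGenerator Q l)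
  set e' := exp (t • yosidaGenerator Q' l)
  have hdecomp : T' t y - T t y =
      -(T' t (y' - y)) + (T' t y' - e' y') + e' (y' - y) + (e' y - e y) - (T t y - e y) := by
    simp only [map_sub]
    abel
  have h₁ : ‖T' t (y' - y)‖ ≤ 1 * ‖y' - y‖ := (T' t).le_of_opNorm_le (hT'.norm_le hQ' ht) _
  have h₂ : ‖e' (y' - y)‖ ≤ 1 * ‖y' - y‖ :=
    e'.le_of_opNorm_le (hQ'.norm_exp_yosidaGenerator_le hl ht.le) _
  have h₃ : ‖T' t y' - e' y'‖ ≤ t * (4 * l⁻¹ * ‖x‖) :=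
    hT'.norm_apply_sub_exp_yosidaGenerator_le hQ' hl hm ht x
  have h₄ : ‖T t y - e y‖ ≤ t * (4 * l⁻¹ * ‖x‖) :=
    hT.norm_apply_sub_exp_yosidaGenerator_le hQ hl hm ht x
  rw [hdecomp]
  refine (norm_sub_le_of_le (norm_add_le_of_le (norm_add_le_of_le (norm_add_le_of_le
    ((norm_neg _).trans_le h₁) h₃) h₂) le_rfl) h₄).trans_eq ?_
  ring

theorem tendstoUniformlyOn_sub_apply_apply {Q' T' : ι → ℝ → X →L[ℂ] X} (hT : IsYosidaLimit Q T)
    (hQ : IsContractivePseudoresolvent Q) (hT' : ∀ i, IsYosidaLimit (Q' i) (T' i))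
    (hQ' : ∀ i, IsContractivePseudoresolvent (Q' i))
    (hlim : ∀ l, 0 < l → ∀ x, Tendsto (fun i => Q' i l x) p (𝓝 (Q l x))) {m : ℝ} (hm : 0 < m)
    (x : X) (r : ℝ) :
    TendstoUniformlyOn (fun i t => (T' i t - T t) (Q m (Q m x))) 0 p (Set.Ioc 0 r) := by
  refine Metric.tendstoUniformlyOn_iff.2 fun ε hε => ?_
  obtain ⟨l, hl, hlε⟩ : ∃ l : ℝ, 0 < l ∧ r * (8 * l⁻¹ * ‖x‖) < ε / 3 := by
    have h : Tendsto (fun l : ℝ => r * (8 * l⁻¹ * ‖x‖)) atTop (𝓝 0) := by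
      simpa using ((tendsto_inv_atTop_zero.const_mul 8).mul_const ‖x‖).const_mul r
    exact ((eventually_gt_atTop 0).and (h.eventually_lt_const (by positivity))).exists
  have hsq : Tendsto (fun i => 2 * ‖Q' i m (Q' i m x) - Q m (Q m x)‖) p (𝓝 0) := by
    simpa using ((IsContractivePseudoresolvent.tendsto_apply_apply hQ' hm
      (hlim m hm) x).sub_const (Q m (Q m x))).norm.const_mul 2
  have hgen : ∀ z, Tendsto (fun i => yosidaGenerator (Q' i) l z) p (𝓝 (yosidaGenerator Q l z)) :=
    fun z => by
      simp only [yosidaGenerator_apply]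
      exact ((hlim l hl z).const_smul _).sub_const _
  have hexp := tendstoUniformlyOn_exp_smul_apply
    (fun i t ht => (hQ' i).norm_exp_yosidaGenerator_le hl ht)
    (fun i => (hQ' i).norm_yosidaGenerator_le hl) hgen (Q m (Q m x)) r
  filter_upwards [hsq.eventually_lt_const (show 0 < ε / 3 by positivity),
    Metric.tendstoUniformlyOn_iff.1 hexp (ε / 3) (by positivity)] with i hi₁ hi₂ t ht
  have hi₃ := hi₂ t ⟨ht.1.le, ht.2⟩
  rw [dist_eq_norm_sub'] at hi₃
  have htr : t * (8 * l⁻¹ * ‖x‖) ≤ r * (8 * l⁻¹ * ‖x‖) := by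
    gcongr
    exact ht.2
  have hle := hT.norm_apply_sub_apply_le hQ (hT' i) (hQ' i) hl hm ht.1 x
  simp only [Pi.zero_apply, dist_zero_left, sub_apply]
  linarith

/-- The Trotter–Kato theorem. On the range of `(Q m)²` the semigroups are compared through their
Yosida approximations, and on the kernel of `Q m` they all vanish. -/
theorem tendstoUniformlyOn {Q' T' : ι → ℝ → X →L[ℂ] X} (hT : IsYosidaLimit Q T)
    (hQ : IsContractivePseudoresolvent Q) (hT' : ∀ i, IsYosidaLimit (Q' i) (T' i))
    (hQ' : ∀ i, IsContractivePseudoresolvent (Q' i))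
    (hlim : ∀ l, 0 < l → ∀ x, Tendsto (fun i => Q' i l x) p (𝓝 (Q l x))) {m : ℝ} (hm : 0 < m)
    (hdense : Dense (((Q m).range ⊔ (Q m).ker : Submodule ℂ X) : Set X))
    (hker : ∀ i x, Q m x = 0 → Q' i m x = 0) (x : X) (r : ℝ) :
    TendstoUniformlyOn (fun i t => T' i t x) (fun t => T t x) p (Set.Ioc 0 r) := by
  suffices h : TendstoUniformlyOn (fun i t => (T' i t - T t) x) 0 p (Set.Ioc 0 r) by
    refine Metric.tendstoUniformlyOn_iff.2 fun ε hε => ?_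
    filter_upwards [Metric.tendstoUniformlyOn_iff.1 h ε hε] with i hi t ht
    simpa [dist_eq_norm_sub'] using hi t ht
  refine hQ.tendstoUniformlyOn_zero hm hdense (C := 1 + 1) ?_ (fun y => ?_) (fun y hy => ?_) x
  · exact Eventually.of_forall fun i t ht =>
      norm_sub_le_of_le ((hT' i).norm_le (hQ' i) ht.1) (hT.norm_le hQ ht.1)
  · exact hT.tendstoUniformlyOn_sub_apply_apply hQ hT' hQ' hlim hm y r
  · refine tendstoUniformlyOn_zero_of_norm_le (g := fun _ => 0)
      (Eventually.of_forall fun i t ht => ?_) tendsto_const_nhds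
    rw [sub_apply, (hT' i).apply_of_ker (hQ' i) ht.1 hm (hker i y hy),
      hT.apply_of_ker hQ ht.1 hm hy, sub_zero, norm_zero]

end IsYosidaLimit

end TrotterKato

section LaplaceTransform

open Polynomial

theorem exists_polynomial_near_eval_exp_neg {g : ℝ → ℝ} (hg : Continuous g)
    (hlim : Tendsto g atTop (𝓝 (g 0))) {ε : ℝ} (hε : 0 < ε) :
    ∃ P : ℝ[X], ∀ t, 0 < t → |P.eval (Real.exp (-t)) - g t| < ε := by
  -- `Real.log 0 = 0`, so this function takes the limit value `g 0` at `0`.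
  have hcont : Continuous fun u : ℝ => g (-Real.log u) := by
    refine continuous_iff_continuousAt.2 fun u => ?_
    rcases eq_or_ne u 0 with rfl | hu
    · rw [continuousAt_iff_punctured_nhds]
      simpa [Function.comp_def] using
        hlim.comp (tendsto_neg_atBot_atTop.comp Real.tendsto_log_nhdsNE_zero)
    · exact hg.continuousAt.comp (Real.continuousAt_log hu).neg
  obtain ⟨P, hP⟩ := exists_polynomial_near_of_continuousOn 0 1 _ hcont.continuousOn ε hε
  refine ⟨P, fun t ht => ?_⟩
  simpa using hP (Real.exp (-t)) ⟨Real.exp_nonneg _, Real.exp_le_one_iff.2 (neg_nonpos.2 ht.le)⟩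

variable {E : Type*} [NormedAddCommGroup E] [NormedSpace ℝ E]

theorem integrableOn_eval_exp_neg_smul {ψ : ℝ → E} (hψ : IntegrableOn ψ (Set.Ioi 0)) (P : ℝ[X]) :
    IntegrableOn (fun t => P.eval (Real.exp (-t)) • ψ t) (Set.Ioi 0) := by
  obtain ⟨C, hC⟩ := (isCompact_Icc (a := (0 : ℝ)) (b := 1)).exists_bound_of_continuousOn
    P.continuous.continuousOn
  refine Integrable.bdd_smul hψ C
    (Continuous.aestronglyMeasurable (P.continuous.comp (by fun_prop))) ?_
  filter_upwards [ae_restrict_mem measurableSet_Ioi] with t ht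
  exact hC _ ⟨Real.exp_nonneg _, Real.exp_le_one_iff.2 (neg_nonpos.2 (le_of_lt ht))⟩

theorem integral_eval_exp_neg_smul_eq_zero {ψ : ℝ → E} (hψ : IntegrableOn ψ (Set.Ioi 0))
    (h : ∀ k : ℕ, ∫ t in Set.Ioi (0 : ℝ), Real.exp (-t) ^ k • ψ t = 0) (P : ℝ[X]) :
    ∫ t in Set.Ioi (0 : ℝ), P.eval (Real.exp (-t)) • ψ t = 0 := by
  induction P using Polynomial.induction_on' with
  | add P R hP hR =>
    simp_rw [eval_add, add_smul]
    rw [integral_add (integrableOn_eval_exp_neg_smul hψ P) (integrableOn_eval_exp_neg_smul hψ R),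
      hP, hR, add_zero]
  | monomial k c =>
    simp_rw [eval_monomial, mul_smul]
    rw [integral_smul, h k, smul_zero]

theorem integral_smul_eq_zero_of_integral_exp_neg_pow_smul_eq_zero {ψ : ℝ → E}
    (hψ : IntegrableOn ψ (Set.Ioi 0))
    (h : ∀ k : ℕ, ∫ t in Set.Ioi (0 : ℝ), Real.exp (-t) ^ k • ψ t = 0) {g : ℝ → ℝ}
    (hg : Continuous g) (hgs : HasCompactSupport g) (hg0 : g 0 = 0) :
    ∫ t in Set.Ioi (0 : ℝ), g t • ψ t = 0 := by
  have hlim : Tendsto g atTop (𝓝 (g 0)) := by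
    rw [hasCompactSupport_iff_eventuallyEq, coclosedCompact_eq_cocompact] at hgs
    rw [hg0]
    exact (hgs.filter_mono atTop_le_cocompact).tendsto
  have hgψ : IntegrableOn (fun t => g t • ψ t) (Set.Ioi 0) := by
    obtain ⟨C, hC⟩ := hgs.exists_bound_of_continuous hg
    exact Integrable.bdd_smul hψ C hg.aestronglyMeasurable (Eventually.of_forall hC)
  have hle : ∀ ε > 0, ‖∫ t in Set.Ioi (0 : ℝ), g t • ψ t‖ ≤
      ε * ∫ t in Set.Ioi (0 : ℝ), ‖ψ t‖ := by
    intro ε hε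
    obtain ⟨P, hP⟩ := exists_polynomial_near_eval_exp_neg hg hlim hε
    rw [← sub_zero (∫ t in Set.Ioi (0 : ℝ), g t • ψ t),
      ← integral_eval_exp_neg_smul_eq_zero hψ h P,
      ← integral_sub hgψ (integrableOn_eval_exp_neg_smul hψ P), ← integral_const_mul]
    refine norm_integral_le_of_norm_le (hψ.norm.const_mul ε) ?_
    filter_upwards [ae_restrict_mem measurableSet_Ioi] with t ht
    rw [← sub_smul, norm_smul, norm_sub_rev]
    gcongr
    exact (hP t ht).le
  have hcont : Continuous fun ε : ℝ => ε * ∫ t in Set.Ioi (0 : ℝ), ‖ψ t‖ := by fun_prop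
  have hzero := (hcont.tendsto 0).mono_left (nhdsWithin_le_nhds (s := Set.Ioi 0))
  rw [zero_mul] at hzero
  exact norm_le_zero_iff.1 (ge_of_tendsto hzero (eventually_nhdsWithin_of_forall hle))

variable [CompleteSpace E]

/-- By Weierstrass approximation in the variable `Real.exp (-t)`: an arithmetic progression of
values of the Laplace transform gives all the moments `∫ exp (-t) ^ k • ψ t`. -/
theorem eqOn_zero_of_integral_exp_neg_mul_smul_eq_zero {φ : ℝ → E}
    (hφ : ContinuousOn φ (Set.Ioi 0)) {w : ℝ}
    (hint : ∀ l, w < l → IntegrableOn (fun t => Real.exp (-(l * t)) • φ t) (Set.Ioi 0))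
    (h : ∀ l, w < l → ∫ t in Set.Ioi (0 : ℝ), Real.exp (-(l * t)) • φ t = 0) :
    Set.EqOn φ 0 (Set.Ioi 0) := by
  set ψ : ℝ → E := fun t => Real.exp (-((w + 1) * t)) • φ t
  have hψ : IntegrableOn ψ (Set.Ioi 0) := hint _ (lt_add_one w)
  have hmoments : ∀ k : ℕ, ∫ t in Set.Ioi (0 : ℝ), Real.exp (-t) ^ k • ψ t = 0 := by
    intro k
    rw [← h (w + 1 + k) (by linarith [k.cast_nonneg (α := ℝ)])]
    congr with t
    rw [smul_smul, ← Real.exp_nat_mul, ← Real.exp_add]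
    congr 2
    ring
  have hae : ∀ᵐ t, t ∈ Set.Ioi (0 : ℝ) → ψ t = 0 := by
    refine isOpen_Ioi.ae_eq_zero_of_integral_contDiff_smul_eq_zero hψ.locallyIntegrableOn ?_
    intro g hg hgs hsupp
    have hg0 : ∀ t, t ∉ Set.Ioi (0 : ℝ) → g t = 0 := fun t ht =>
      image_eq_zero_of_notMem_tsupport fun hmem => ht (hsupp hmem)
    rw [← setIntegral_eq_integral_of_forall_compl_eq_zero (s := Set.Ioi 0)
      fun t ht => by rw [hg0 t ht, zero_smul]]
    exact integral_smul_eq_zero_of_integral_exp_neg_pow_smul_eq_zero hψ hmoments hg.continuous hgs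
      (hg0 0 Set.self_notMem_Ioi)
  have hφae : φ =ᵐ[volume.restrict (Set.Ioi 0)] 0 := by
    filter_upwards [(ae_restrict_iff' measurableSet_Ioi).2 hae] with t ht
    exact (smul_eq_zero.1 ht).resolve_left (Real.exp_pos _).ne'
  exact Measure.eqOn_open_of_ae_eq hφae isOpen_Ioi hφ continuousOn_const

end LaplaceTransform

theorem HasBoundedInverse.unique {X : Type*} [NormedAddCommGroup X] [NormedSpace ℂ X]
    {B : Set (X × X)} {R R' : X →L[ℂ] X} (hR : HasBoundedInverse B R)
    (hR' : HasBoundedInverse B R') : R = R' :=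
  ContinuousLinearMap.ext fun _ => ((hR' _ _).1 ((hR _ _).2 rfl)).symm

theorem IsSemigroupGeneratedByNeg.eqOn {X : Type*} [NormedAddCommGroup X] [NormedSpace ℂ X]
    [CompleteSpace X] {A : Submodule ℂ (X × X)} {S S' : ℝ → X →L[ℂ] X}
    (hS : IsSemigroupGeneratedByNeg A S) (hS' : IsSemigroupGeneratedByNeg A S') :
    Set.EqOn S S' (Set.Ioi 0) := by
  obtain ⟨hdeg, w, hw⟩ := hS
  obtain ⟨hdeg', w', hw'⟩ := hS'
  intro t ht
  ext x
  have hlaplace : ∀ l, max w w' < l →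
      IntegrableOn (fun t => Real.exp (-(l * t)) • (S t x - S' t x)) (Set.Ioi 0) ∧
        ∫ t in Set.Ioi (0 : ℝ), Real.exp (-(l * t)) • (S t x - S' t x) = 0 := by
    intro l hl
    obtain ⟨R, hR, hRS⟩ := hw l ((le_max_left _ _).trans_lt hl)
    obtain ⟨R', hR', hRS'⟩ := hw' l ((le_max_right _ _).trans_lt hl)
    simp_rw [smul_sub]
    refine ⟨(hRS x).1.sub (hRS' x).1, ?_⟩
    rw [integral_sub (hRS x).1 (hRS' x).1, ← (hRS x).2, ← (hRS' x).2, hR.unique hR', sub_self]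
  exact sub_eq_zero.1 <| eqOn_zero_of_integral_exp_neg_mul_smul_eq_zero
    ((hdeg.strongly_continuous x).sub (hdeg'.strongly_continuous x))
    (fun l hl => (hlaplace l hl).1) (fun l hl => (hlaplace l hl).2) ht

section LaxMilgram

open ContinuousLinearMap (adjoint)

variable {V : Type*} [NormedAddCommGroup V] [InnerProductSpace ℂ V]

/-- The form `(u, v) ↦ inner ℂ v (M u)` is coercive on `V`, with the constant `α > 0`. -/
structure IsCoerciveWith (α : ℝ) (M : V →L[ℂ] V) : Prop where
  pos : 0 < α
  le_re_inner : ∀ u, α * ‖u‖ ^ 2 ≤ (inner ℂ u (M u)).re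

theorem mul_le_of_mul_sq_le {a b c : ℝ} (hb : 0 ≤ b) (hc : 0 ≤ c) (h : a * b ^ 2 ≤ b * c) :
    a * b ≤ c := by
  rcases hb.eq_or_lt with rfl | hb
  · simpa using hc
  · exact le_of_mul_le_mul_left (by linarith) hb

namespace IsCoerciveWith

variable {α : ℝ} {M : V →L[ℂ] V}

theorem mul_norm_le (hM : IsCoerciveWith α M) (u : V) : α * ‖u‖ ≤ ‖M u‖ :=
  mul_le_of_mul_sq_le (norm_nonneg u) (norm_nonneg _)
    ((hM.le_re_inner u).trans (re_inner_le_norm (𝕜 := ℂ) u (M u)))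

theorem eq_zero_of_inner_eq_zero (hM : IsCoerciveWith α M) {u : V} (hu : inner ℂ u (M u) = 0) :
    u = 0 := by
  have h := hM.le_re_inner u
  rw [hu, Complex.zero_re] at h
  by_contra hne
  exact h.not_gt (mul_pos hM.pos (pow_pos (norm_pos_iff.2 hne) 2))

theorem isInvertible [CompleteSpace V] (hM : IsCoerciveWith α M) : M.IsInvertible := by
  have hanti : AntilipschitzWith α⁻¹.toNNReal M := by
    refine M.antilipschitz_of_bound fun u => ?_
    rw [Real.coe_toNNReal _ (inv_nonneg.2 hM.pos.le), le_inv_mul_iff₀ hM.pos]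
    exact hM.mul_norm_le u
  have hrange : M.range = ⊤ := by
    have : CompleteSpace M.range :=
      (hanti.isClosed_range M.uniformContinuous).completeSpace_coe
    rw [← Submodule.orthogonal_eq_bot_iff, Submodule.eq_bot_iff]
    exact fun w hw => hM.eq_zero_of_inner_eq_zero
      (Submodule.inner_left_of_mem_orthogonal (LinearMap.mem_range_self _ w) hw)
  exact ⟨ContinuousLinearEquiv.ofBijective M (LinearMap.ker_eq_bot.2 hanti.injective) hrange, rfl⟩

/-- Céa's lemma. -/
theorem mul_norm_sub_le (hM : IsCoerciveWith α M) {W : Submodule ℂ V} {u y z : V} (hy : y ∈ W)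
    (hz : z ∈ W) (hgalerkin : ∀ v ∈ W, inner ℂ v (M (y - u)) = 0) :
    α * ‖y - u‖ ≤ ‖M‖ * ‖u - z‖ := by
  have hinner : inner ℂ (y - u) (M (y - u)) = inner ℂ (z - u) (M (y - u)) := by
    rw [← sub_add_sub_cancel y z u, inner_add_left, sub_add_sub_cancel,
      hgalerkin _ (W.sub_mem hy hz), zero_add]
  refine mul_le_of_mul_sq_le (norm_nonneg _) (by positivity) ((hM.le_re_inner _).trans ?_)
  rw [hinner]
  calc (inner ℂ (z - u) (M (y - u))).re ≤ ‖z - u‖ * ‖M (y - u)‖ :=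
        re_inner_le_norm (𝕜 := ℂ) (z - u) (M (y - u))
    _ ≤ ‖z - u‖ * (‖M‖ * ‖y - u‖) := by
        gcongr
        exact M.le_opNorm _
    _ = ‖y - u‖ * (‖M‖ * ‖u - z‖) := by
        rw [norm_sub_rev z u]
        ring

theorem tendsto_of_tendsto_infDist (hM : IsCoerciveWith α M) {ι : Type*} {p : Filter ι}
    {W : ι → Submodule ℂ V} {u : V}
    (hW : Tendsto (fun i => Metric.infDist u (W i : Set V)) p (𝓝 0)) {y : ι → V}
    (hy : ∀ i, y i ∈ W i) (hgalerkin : ∀ i, ∀ v ∈ W i, inner ℂ v (M (y i - u)) = 0) :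
    Tendsto y p (𝓝 u) := by
  refine tendsto_iff_norm_sub_tendsto_zero.2 (squeeze_zero
    (g := fun i => α⁻¹ * (‖M‖ * Metric.infDist u (W i : Set V)))
    (fun i => norm_nonneg _) (fun i => ?_) (by simpa using (hW.const_mul ‖M‖).const_mul α⁻¹))
  have : Nonempty ((W i : Set V)) := ⟨0, (W i).zero_mem⟩
  rw [le_inv_mul_iff₀ hM.pos, Metric.infDist_eq_iInf, Real.mul_iInf_of_nonneg (norm_nonneg M)]
  refine le_ciInf fun z => ?_
  rw [dist_eq_norm]
  exact hM.mul_norm_sub_le (hy i) z.2 (hgalerkin i)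

end IsCoerciveWith

theorem exists_inner_eq_sesquilinear [CompleteSpace V] {a : V →ₗ[ℂ] V →ₗ⋆[ℂ] ℂ} {C : ℝ}
    (ha : ∀ u v, ‖a u v‖ ≤ C * ‖u‖ * ‖v‖) : ∃ L : V →L[ℂ] V, ∀ u v, inner ℂ v (L u) = a u v := by
  let B : V →L⋆[ℂ] V →L[ℂ] ℂ := a.flip.mkContinuous₂ C fun v u => by
    rw [mul_right_comm]
    exact ha u v
  refine ⟨adjoint (InnerProductSpace.continuousLinearMapOfBilin B), fun u v => ?_⟩
  rw [ContinuousLinearMap.adjoint_inner_right,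
    InnerProductSpace.continuousLinearMapOfBilin_apply]
  rfl

variable [CompleteSpace V]

/-- The compression of `L` to `W`: on `W` it represents the restriction of the form
`(u, v) ↦ inner ℂ v (L u)`. -/
noncomputable def compression (L : V →L[ℂ] V) (W : Submodule ℂ V) [CompleteSpace W] :
    W →L[ℂ] W :=
  adjoint W.subtypeL ∘L L ∘L W.subtypeL

theorem inner_compression (L : V →L[ℂ] V) (W : Submodule ℂ V) [CompleteSpace W] (u v : W) :
    inner ℂ v (compression L W u) = inner ℂ (v : V) (L u) :=
  ContinuousLinearMap.adjoint_inner_right W.subtypeL v (L u)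

theorem IsCoerciveWith.compression {α : ℝ} {L : V →L[ℂ] V} (hL : IsCoerciveWith α L)
    (W : Submodule ℂ V) [CompleteSpace W] : IsCoerciveWith α (compression L W) where
  pos := hL.pos
  le_re_inner u := by
    rw [inner_compression]
    exact hL.le_re_inner u

end LaxMilgram

section FormResolvent

open ContinuousLinearMap (adjoint)

variable {V : Type*} [NormedAddCommGroup V] [InnerProductSpace ℂ V] [CompleteSpace V]
variable {H : Type*} [NormedAddCommGroup H] [InnerProductSpace ℂ H] [CompleteSpace H]

/-- The operator on `V` which represents the form `(L u, v)_V + l (j u, j v)_H`. -/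
noncomputable def shiftedOperator (j : V →L[ℂ] H) (L : V →L[ℂ] V) (l : ℝ) : V →L[ℂ] V :=
  L + l • (adjoint j ∘L j)

/-- The map taking `f` to the solution `u` of `(L u, v)_V + l (j u, j v)_H = (f, j v)_H` for all
`v`, with the junk value `0` if `shiftedOperator j L l` is not invertible. -/
noncomputable def formSolution (j : V →L[ℂ] H) (L : V →L[ℂ] V) (l : ℝ) : H →L[ℂ] V :=
  (shiftedOperator j L l).inverse ∘L adjoint j

/-- The resolvent in `H`, at `-l`, of the graph associated with the form `(L u, v)_V`. -/
noncomputable def formResolvent (j : V →L[ℂ] H) (L : V →L[ℂ] V) (l : ℝ) : H →L[ℂ] H :=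
  j ∘L formSolution j L l

variable {j : V →L[ℂ] H} {L : V →L[ℂ] V} {α l : ℝ}

theorem inner_shiftedOperator (u v : V) :
    inner ℂ v (shiftedOperator j L l u) = inner ℂ v (L u) + l * inner ℂ (j v) (j u) := by
  simp [shiftedOperator, inner_smul_right_eq_smul,
    ContinuousLinearMap.adjoint_inner_right]

theorem re_inner_shiftedOperator (u : V) : (inner ℂ u (shiftedOperator j L l u)).re =
    (inner ℂ u (L u)).re + l * ‖j u‖ ^ 2 := by
  rw [inner_shiftedOperator, inner_self_eq_norm_sq_to_K]
  simp [← Complex.ofReal_pow]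

theorem IsCoerciveWith.shiftedOperator (hL : IsCoerciveWith α L) (hl : 0 ≤ l) :
    IsCoerciveWith α (shiftedOperator j L l) where
  pos := hL.pos
  le_re_inner u := by
    rw [re_inner_shiftedOperator]
    exact (hL.le_re_inner u).trans (le_add_of_nonneg_right (by positivity))

theorem compression_shiftedOperator (W : Submodule ℂ V) [CompleteSpace W] :
    compression (shiftedOperator j L l) W =
      shiftedOperator (j ∘L W.subtypeL) (compression L W) l := by
  ext u : 1
  refine ext_inner_left ℂ fun v => ?_
  simp only [inner_compression, inner_shiftedOperator, ContinuousLinearMap.comp_apply,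
    Submodule.subtypeL_apply]

namespace IsCoerciveWith

theorem shiftedOperator_formSolution (hL : IsCoerciveWith α L) (hl : 0 ≤ l) (f : H) :
    _root_.shiftedOperator j L l (formSolution j L l f) = adjoint j f :=
  (hL.shiftedOperator hl).isInvertible.self_apply_inverse _

theorem inner_formSolution (hL : IsCoerciveWith α L) (hl : 0 ≤ l) (f : H) (v : V) :
    inner ℂ v (_root_.shiftedOperator j L l (formSolution j L l f)) = inner ℂ (j v) f := by
  rw [hL.shiftedOperator_formSolution hl, ContinuousLinearMap.adjoint_inner_right]

theorem eq_formSolution_iff (hL : IsCoerciveWith α L) (hl : 0 ≤ l) {u : V} {f : H} :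
    u = formSolution j L l f ↔
      ∀ v, inner ℂ v (L u) + l * inner ℂ (j v) (j u) = inner ℂ (j v) f := by
  simp_rw [← inner_shiftedOperator, ← ContinuousLinearMap.adjoint_inner_right j]
  rw [← ext_iff_inner_left, formSolution, ContinuousLinearMap.comp_apply, eq_comm,
    (hL.shiftedOperator hl).isInvertible.inverse_apply_eq, eq_comm]

theorem norm_formResolvent_le (hL : IsCoerciveWith α L) (hl : 0 < l) :
    ‖formResolvent j L l‖ ≤ l⁻¹ := by
  refine ContinuousLinearMap.opNorm_le_bound _ (inv_nonneg.2 hl.le) fun f => ?_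
  rw [le_inv_mul_iff₀ hl]
  set u := formSolution j L l f
  refine mul_le_of_mul_sq_le (b := ‖j u‖) (norm_nonneg _) (norm_nonneg f) ?_
  have hpos : 0 ≤ (inner ℂ u (L u)).re :=
    (mul_nonneg hL.pos.le (sq_nonneg _)).trans (hL.le_re_inner u)
  calc l * ‖j u‖ ^ 2 ≤ (inner ℂ u (_root_.shiftedOperator j L l u)).re := by
        rw [re_inner_shiftedOperator]
        linarith
    _ = (inner ℂ (j u) f).re := by rw [hL.inner_formSolution hl.le]
    _ ≤ ‖j u‖ * ‖f‖ := re_inner_le_norm (𝕜 := ℂ) (j u) f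

theorem isContractivePseudoresolvent_formResolvent (hL : IsCoerciveWith α L) :
    IsContractivePseudoresolvent (formResolvent j L) where
  sub_eq l m hl hm := by
    ext f
    have hsol : formSolution j L l f - formSolution j L m f =
        formSolution j L l ((m - l) • formResolvent j L m f) := by
      refine (hL.eq_formSolution_iff hl.le).2 fun v => ?_
      have h₁ := (hL.eq_formSolution_iff (j := j) hl.le).1 (Eq.refl (formSolution j L l f)) v
      have h₂ := (hL.eq_formSolution_iff (j := j) hm.le).1 (Eq.refl (formSolution j L m f)) v
      simp only [map_sub, inner_sub_right, inner_smul_right_eq_smul, formResolvent,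
        ContinuousLinearMap.comp_apply, Complex.real_smul, Complex.ofReal_sub]
      linear_combination h₁ - h₂
    calc formResolvent j L l f - formResolvent j L m f
        = j (formSolution j L l f - formSolution j L m f) := (map_sub j _ _).symm
      _ = (m - l) • formResolvent j L l (formResolvent j L m f) := by
          rw [hsol]
          exact (formResolvent j L l).map_smul_of_tower _ _
  norm_le _ hl := hL.norm_formResolvent_le hl

theorem adjoint_apply_eq_zero_of_inner_formResolvent (hL : IsCoerciveWith α L) (hl : 0 ≤ l)
    {f : H} (hf : inner ℂ (formResolvent j L l f) f = 0) : adjoint j f = 0 := by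
  have hsol : formSolution j L l f = 0 :=
    (hL.shiftedOperator hl).eq_zero_of_inner_eq_zero ((hL.inner_formSolution hl f _).trans hf)
  rw [← hL.shiftedOperator_formSolution hl, hsol, map_zero]

theorem formResolvent_eq_zero_iff (hL : IsCoerciveWith α L) (hl : 0 ≤ l) {f : H} :
    formResolvent j L l f = 0 ↔ adjoint j f = 0 := by
  refine ⟨fun h => hL.adjoint_apply_eq_zero_of_inner_formResolvent hl ?_, fun h => ?_⟩
  · rw [h, inner_zero_left]
  · simp only [formResolvent, formSolution, ContinuousLinearMap.comp_apply, h, map_zero]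

theorem dense_range_formResolvent_sup_ker (hL : IsCoerciveWith α L) (hl : 0 ≤ l) :
    Dense (((formResolvent j L l).range ⊔ (formResolvent j L l).ker : Submodule ℂ H) : Set H) := by
  set Q := formResolvent j L l
  rw [Submodule.dense_iff_topologicalClosure_eq_top, Submodule.topologicalClosure_eq_top_iff,
    Submodule.eq_bot_iff]
  intro f hf
  rw [← Submodule.inf_orthogonal] at hf
  have hker : f ∈ Q.ker := (hL.formResolvent_eq_zero_iff hl).2 <|
    hL.adjoint_apply_eq_zero_of_inner_formResolvent hl
      (Submodule.inner_right_of_mem_orthogonal (LinearMap.mem_range_self _ f) hf.1)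
  exact inner_self_eq_zero.1 (Submodule.inner_right_of_mem_orthogonal hker hf.2)

theorem hasBoundedInverse_shiftedGraph (hL : IsCoerciveWith α L) {a : V →ₗ[ℂ] V →ₗ⋆[ℂ] ℂ} {w : ℝ}
    (ha : ∀ u v, inner ℂ v (L u) = a u v + w * inner ℂ (j v) (j u)) (hl : w ≤ l) :
    HasBoundedInverse (shiftedGraph (l : ℂ) (associatedGraph (j : V →ₗ[ℂ] H) a))
      (formResolvent j L (l - w)) := by
  have hsol : ∀ u f, u = formSolution j L (l - w) f ↔
      ∀ v, a u v = inner ℂ (j v) (f - (l : ℂ) • j u) := by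
    intro u f
    rw [hL.eq_formSolution_iff (sub_nonneg.2 hl)]
    refine forall_congr' fun v => ?_
    rw [ha, inner_sub_right, inner_smul_right]
    push_cast
    constructor <;> intro h <;> linear_combination h
  intro x f
  constructor
  · rintro ⟨_, y, ⟨u, rfl, hy⟩, heq⟩
    obtain ⟨rfl, rfl⟩ := Prod.mk.inj heq
    refine congrArg j ((hsol u _).2 fun v => ?_).symm
    rw [hy v]
    simp
  · rintro rfl
    exact ⟨_, f - (l : ℂ) • formResolvent j L (l - w) f, ⟨_, rfl, (hsol _ f).1 rfl⟩,
      Prod.ext rfl (add_sub_cancel _ _).symm⟩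

theorem isSemigroupGeneratedByNeg_associatedGraph (hL : IsCoerciveWith α L)
    {a : V →ₗ[ℂ] V →ₗ⋆[ℂ] ℂ} {w : ℝ}
    (ha : ∀ u v, inner ℂ v (L u) = a u v + w * inner ℂ (j v) (j u)) {T : ℝ → H →L[ℂ] H}
    (hT : IsYosidaLimit (formResolvent j L) T) :
    IsSemigroupGeneratedByNeg (associatedGraph (j : V →ₗ[ℂ] H) a)
      fun t => Real.exp (w * t) • T t := by
  have hQ := hL.isContractivePseudoresolvent_formResolvent (j := j)
  refine ⟨hT.isDegenerateSemigroup_exp_smul hQ w, w, fun l hl =>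
    ⟨_, hL.hasBoundedInverse_shiftedGraph ha hl.le, fun x => ?_⟩⟩
  have hexp : (fun t : ℝ => Real.exp (-(l * t)) • (Real.exp (w * t) • T t) x) =
      fun t => Real.exp (-((l - w) * t)) • T t x := by
    ext t
    rw [smul_apply, smul_smul, ← Real.exp_add]
    congr 2
    ring
  rw [hexp]
  exact ⟨hT.integrableOn hQ (sub_pos.2 hl) x,
    (hT.integral_exp_neg_mul_smul_apply hQ (sub_pos.2 hl) x).symm⟩

theorem formResolvent_compression_eq_zero (hL : IsCoerciveWith α L) (hl : 0 ≤ l)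
    (W : Submodule ℂ V) [CompleteSpace W] {f : H} (hf : formResolvent j L l f = 0) :
    formResolvent (j ∘L W.subtypeL) (_root_.compression L W) l f = 0 := by
  rw [(hL.compression W).formResolvent_eq_zero_iff hl, ContinuousLinearMap.adjoint_comp,
    ContinuousLinearMap.comp_apply, (hL.formResolvent_eq_zero_iff hl).1 hf, map_zero]

theorem tendsto_formResolvent_compression (hL : IsCoerciveWith α L) (hl : 0 ≤ l) {ι : Type*}
    {p : Filter ι} {W : ι → Submodule ℂ V} [∀ i, CompleteSpace (W i)]
    (hW : ∀ u, Tendsto (fun i => Metric.infDist u (W i : Set V)) p (𝓝 0)) (f : H) :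
    Tendsto (fun i => formResolvent (j ∘L (W i).subtypeL) (_root_.compression L (W i)) l f) p
      (𝓝 (formResolvent j L l f)) := by
  let y i := formSolution (j ∘L (W i).subtypeL) (_root_.compression L (W i)) l f
  suffices h : Tendsto (fun i => (y i : V)) p (𝓝 (formSolution j L l f)) from
    (j.continuous.tendsto _).comp h
  refine (hL.shiftedOperator (j := j) hl).tendsto_of_tendsto_infDist (hW _) (fun i => (y i).2)
    fun i v hv => ?_
  have hWi := (hL.compression (W i)).inner_formSolution (j := j ∘L (W i).subtypeL) hl f ⟨v, hv⟩
  rw [← compression_shiftedOperator, inner_compression] at hWi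
  rw [map_sub, inner_sub_right, hL.inner_formSolution hl]
  exact sub_eq_zero.2 hWi

end IsCoerciveWith

end FormResolvent

section ClosedForms

theorem norm_mul_cos_le_re_of_mem_closure_openSector {θ : ℝ} (hθ : θ ≤ Real.pi) {z : ℂ}
    (hz : z ∈ closure (openSector θ)) : ‖z‖ * Real.cos θ ≤ z.re := by
  have hclosed : IsClosed {z : ℂ | ‖z‖ * Real.cos θ ≤ z.re} :=
    isClosed_le (by fun_prop) Complex.continuous_re
  refine closure_minimal (fun w hw => ?_) hclosed hz
  calc ‖w‖ * Real.cos θ ≤ ‖w‖ * Real.cos |w.arg| := by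
        gcongr
        exact Real.cos_le_cos_of_nonneg_of_le_pi (abs_nonneg _) hθ hw.2.le
    _ = w.re := by rw [Real.cos_abs, Complex.norm_mul_cos_arg]

theorem continuous_of_injective_of_continuous_comp {𝕜 E F G : Type*} [NontriviallyNormedField 𝕜]
    [NormedAddCommGroup E] [NormedSpace 𝕜 E] [CompleteSpace E]
    [NormedAddCommGroup F] [NormedSpace 𝕜 F] [CompleteSpace F] [TopologicalSpace G] [T2Space G]
    {f : E →ₗ[𝕜] F} {g : F → G} (hg : Continuous g) (hg_inj : Function.Injective g)
    (hgf : Continuous fun x => g (f x)) : Continuous f :=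
  f.continuous_of_seq_closed_graph fun _ x y hu hy =>
    hg_inj (tendsto_nhds_unique ((hg.tendsto y).comp hy) ((hgf.tendsto x).comp hu))

section Polarization

variable {V : Type*} [NormedAddCommGroup V] [InnerProductSpace ℂ V] {a : V →ₗ[ℂ] V →ₗ⋆[ℂ] ℂ}
  {K : ℝ}

theorem sesquilinear_polarization (u v : V) :
    4 * a u v = a (u + v) (u + v) - a (u - v) (u - v) +
      Complex.I * (a (u + Complex.I • v) (u + Complex.I • v) -
        a (u - Complex.I • v) (u - Complex.I • v)) := by
  simp only [map_add, map_sub, LinearMap.add_apply, LinearMap.sub_apply, map_smul,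
    LinearMap.smul_apply, LinearMap.map_smulₛₗ, smul_eq_mul, Complex.conj_I]
  linear_combination (2 * a u v - 2 * a v u) * Complex.I_sq

theorem norm_sesquilinear_le_of_norm_diag_le (h : ∀ u, ‖a u u‖ ≤ K * ‖u‖ ^ 2) (u v : V) :
    ‖a u v‖ ≤ K * (‖u‖ ^ 2 + ‖v‖ ^ 2) := by
  have hdiff : ∀ w, ‖a (u + w) (u + w) - a (u - w) (u - w)‖ ≤ 2 * K * (‖u‖ ^ 2 + ‖w‖ ^ 2) := by
    intro w
    calc _ ≤ K * ‖u + w‖ ^ 2 + K * ‖u - w‖ ^ 2 :=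
          norm_sub_le_of_le (h (u + w)) (h (u - w))
      _ = 2 * K * (‖u‖ ^ 2 + ‖w‖ ^ 2) := by
          linear_combination K * parallelogram_law_with_norm ℂ u w
  have hI := hdiff (Complex.I • v)
  rw [norm_smul, Complex.norm_I, one_mul] at hI
  have h4 : 4 * ‖a u v‖ ≤ 2 * K * (‖u‖ ^ 2 + ‖v‖ ^ 2) + 2 * K * (‖u‖ ^ 2 + ‖v‖ ^ 2) := by
    calc 4 * ‖a u v‖ = ‖4 * a u v‖ := by simp
      _ ≤ _ := by
        rw [sesquilinear_polarization]
        refine norm_add_le_of_le (hdiff v) ?_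
        rwa [norm_mul, Complex.norm_I, one_mul]
  linarith

theorem norm_sesquilinear_le_mul_of_norm_diag_le (h : ∀ u, ‖a u u‖ ≤ K * ‖u‖ ^ 2) (u v : V) :
    ‖a u v‖ ≤ 2 * K * ‖u‖ * ‖v‖ := by
  rcases eq_or_ne u 0 with rfl | hu
  · simp
  rcases eq_or_ne v 0 with rfl | hv
  · simp
  have hu' := norm_pos_iff.2 hu
  have hv' := norm_pos_iff.2 hv
  have hunit := norm_sesquilinear_le_of_norm_diag_le h
    ((‖u‖ : ℂ)⁻¹ • u) ((‖v‖ : ℂ)⁻¹ • v)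
  simp only [map_smul, LinearMap.smul_apply, LinearMap.map_smulₛₗ, norm_smul, map_inv₀,
    Complex.conj_ofReal, norm_inv, Complex.norm_real, norm_norm, inv_mul_cancel₀ hu'.ne',
    inv_mul_cancel₀ hv'.ne'] at hunit
  calc ‖a u v‖ = ‖u‖ * ‖v‖ * (‖v‖⁻¹ * (‖u‖⁻¹ * ‖a u v‖)) := by field_simp
    _ ≤ ‖u‖ * ‖v‖ * (K * (1 ^ 2 + 1 ^ 2)) :=
        mul_le_mul_of_nonneg_left hunit (by positivity)
    _ = 2 * K * ‖u‖ * ‖v‖ := by ring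

end Polarization

namespace IsCompleteInnerProduct

variable {W : Type*} [AddCommGroup W] [Module ℂ W] {b : W → W → ℂ}

/-- The inner product space structure given by `b`, which is linear in its first variable whereas
`inner` is linear in the second one. -/
abbrev core (hb : IsCompleteInnerProduct b) : InnerProductSpace.Core ℂ W where
  inner x y := b y x
  conj_inner_symm x y := hb.conj_symm y x
  re_inner_nonneg x := by
    rcases eq_or_ne x 0 with rfl | hx
    · have hzero : b 0 0 = 0 := by simpa using hb.smul_left 0 0 0
      simp [hzero]
    · exact (hb.pos x hx).le
  add_left x y z := by rw [← hb.conj_symm, hb.add_left, map_add, hb.conj_symm, hb.conj_symm]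
  smul_left x y r := by rw [← hb.conj_symm, hb.smul_left, map_mul, hb.conj_symm]
  definite x hx := by
    by_contra hne
    exact (hb.pos x hne).ne' (by rw [hx, Complex.zero_re])

theorem completeSpace (hb : IsCompleteInnerProduct b) :
    letI := hb.core.toNormedAddCommGroup
    CompleteSpace W := by
  let := hb.core.toNormedAddCommGroup
  refine Metric.complete_of_cauchySeq_tendsto fun x hx => ?_
  obtain ⟨u, hu⟩ := hb.complete x fun ε hε => by
    obtain ⟨N, hN⟩ := Metric.cauchySeq_iff.1 hx ε hε
    exact ⟨N, fun m hm n hn => (dist_eq_norm (x m) (x n)).symm.trans_lt (hN m hm n hn)⟩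
  exact ⟨u, tendsto_iff_norm_sub_tendsto_zero.2 hu⟩

/-- The closed graph theorem makes the norm of `b` equivalent to the given one, since both dominate
the norm of `j u`. The space `W` is a copy of `V` which carries the norm of `b`. -/
theorem exists_norm_bounds (hb : IsCompleteInnerProduct b) {V H : Type*} [NormedAddCommGroup V]
    [NormedSpace ℂ V] [CompleteSpace V] [NormedAddCommGroup H] [NormedSpace ℂ H] {j : V →L[ℂ] H}
    (hj : Function.Injective j) (e : V ≃ₗ[ℂ] W) {c : ℝ} (hc : 0 < c)
    (hjb : ∀ u, c * ‖j u‖ ^ 2 ≤ (b (e u) (e u)).re) :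
    ∃ α > 0, ∃ C, ∀ u, α * ‖u‖ ^ 2 ≤ (b (e u) (e u)).re ∧ (b (e u) (e u)).re ≤ C * ‖u‖ ^ 2 := by
  let := hb.core.toNormedAddCommGroup
  let : InnerProductSpace ℂ W := .ofCore hb.core.toCore
  have := hb.completeSpace
  have hsq : ∀ x : W, (b x x).re = ‖x‖ ^ 2 := fun x => (norm_sq_eq_re_inner (𝕜 := ℂ) x).symm
  simp only [hsq] at hjb ⊢
  have hje : Continuous ((j : V →ₗ[ℂ] H) ∘ₗ e.symm.toLinearMap) := by
    refine AddMonoidHomClass.continuous_of_bound _ √(c⁻¹) fun y => ?_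
    have hy := hjb (e.symm y)
    rw [e.apply_symm_apply, ← le_inv_mul_iff₀ hc] at hy
    calc ‖j (e.symm y)‖ ≤ √(c⁻¹ * ‖y‖ ^ 2) := Real.le_sqrt_of_sq_le hy
      _ = √c⁻¹ * ‖y‖ := by rw [Real.sqrt_mul (inv_nonneg.2 hc.le), Real.sqrt_sq (norm_nonneg y)]
  have he : Continuous e := continuous_of_injective_of_continuous_comp (f := e.toLinearMap) hje
    (hj.comp e.symm.injective) (by simpa using j.continuous)
  let E := e.toContinuousLinearEquivOfContinuous he
  obtain ⟨C, -, hC⟩ := (E : V →L[ℂ] W).bound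
  obtain ⟨D, hD, hDE⟩ := (E.symm : W →L[ℂ] V).bound
  refine ⟨(D ^ 2)⁻¹, by positivity, C ^ 2, fun u => ⟨?_, ?_⟩⟩
  · rw [inv_mul_le_iff₀ (by positivity), ← mul_pow]
    gcongr
    exact (congrArg norm (E.symm_apply_apply u)).ge.trans (hDE (E u))
  · rw [← mul_pow]
    gcongr
    exact hC u

end IsCompleteInnerProduct

section

variable {V : Type*} [AddCommGroup V] [Module ℂ V] {a : V →ₗ[ℂ] V →ₗ⋆[ℂ] ℂ}
variable {H : Type*} [NormedAddCommGroup H] [InnerProductSpace ℂ H] {j : V →ₗ[ℂ] H}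

theorem re_formRealPart_add_mul_inner (w : ℝ) (u : V) :
    (formRealPart a u u + (w : ℂ) * inner ℂ (j u) (j u)).re = (a u u).re + w * ‖j u‖ ^ 2 := by
  simp only [formRealPart, inner_self_eq_norm_sq_to_K]
  simp [← Complex.ofReal_pow]
  ring

theorem IsVertex.exists_norm_le_mul_re {γ : ℝ} (hγ : IsVertex j a γ) : ∃ κ > 0, ∀ u,
    ‖a u u - ((γ * ‖j u‖ ^ 2 : ℝ) : ℂ)‖ ≤ κ * ((a u u).re - γ * ‖j u‖ ^ 2) := by
  obtain ⟨θ, ⟨hθ0, hθ⟩, hsec⟩ := hγ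
  have hcos : 0 < Real.cos θ := Real.cos_pos_of_mem_Ioo ⟨by linarith, hθ⟩
  refine ⟨(Real.cos θ)⁻¹, inv_pos.2 hcos, fun u => ?_⟩
  have h := norm_mul_cos_le_re_of_mem_closure_openSector (by linarith) (hsec u)
  rw [Complex.sub_re, Complex.ofReal_re] at h
  rwa [le_inv_mul_iff₀ hcos, mul_comm]

end

variable {V : Type*} [NormedAddCommGroup V] [InnerProductSpace ℂ V]
variable {H : Type*} [NormedAddCommGroup H] [InnerProductSpace ℂ H]

/-- `a` is bounded and `j`-elliptic: adding a multiple of `(j u, j v)_H` makes it coercive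
on `V`. -/
structure IsEllipticForm (j : V →L[ℂ] H) (a : V →ₗ[ℂ] V →ₗ⋆[ℂ] ℂ) : Prop where
  bounded : ∃ M : ℝ, ∀ u v, ‖a u v‖ ≤ M * ‖u‖ * ‖v‖
  elliptic : ∃ w : ℝ, ∃ α > 0, ∀ u, α * ‖u‖ ^ 2 ≤ (a u u).re + w * ‖j u‖ ^ 2

theorem IsClosedForm.isEllipticForm [CompleteSpace V] {j : V →L[ℂ] H}
    (hj : Function.Injective j) {a : V →ₗ[ℂ] V →ₗ⋆[ℂ] ℂ}
    (ha : IsClosedForm (j : V →ₗ[ℂ] H) a) : IsEllipticForm j a := by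
  obtain ⟨γ, w, hγ, hw, hb⟩ := ha
  obtain ⟨κ, hκ, hsec⟩ := hγ.exists_norm_le_mul_re
  simp only [ContinuousLinearMap.coe_coe] at hsec
  have hre : ∀ u, 0 ≤ (a u u).re - γ * ‖j u‖ ^ 2 := fun u =>
    nonneg_of_mul_nonneg_right ((norm_nonneg _).trans (hsec u)) hκ
  have hγw : 0 < γ + w := neg_lt_iff_pos_add'.1 hw
  obtain ⟨α, hα, C, hC⟩ := hb.exists_norm_bounds hj (LinearEquiv.refl ℂ V) hγw fun u => by
    rw [LinearEquiv.refl_apply, re_formRealPart_add_mul_inner, ContinuousLinearMap.coe_coe]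
    linarith [hre u]
  simp only [LinearEquiv.refl_apply, re_formRealPart_add_mul_inner] at hC
  simp only [ContinuousLinearMap.coe_coe] at hC
  refine ⟨⟨_, norm_sesquilinear_le_mul_of_norm_diag_le (K := κ * C + |γ| * ‖j‖ ^ 2) fun u => ?_⟩,
    w, α, hα, fun u => (hC u).1⟩
  have hre_le : (a u u).re - γ * ‖j u‖ ^ 2 ≤ C * ‖u‖ ^ 2 := by
    have : 0 ≤ (γ + w) * ‖j u‖ ^ 2 := by positivity
    linarith [(hC u).2]
  calc ‖a u u‖ ≤ ‖a u u - ((γ * ‖j u‖ ^ 2 : ℝ) : ℂ)‖ + ‖((γ * ‖j u‖ ^ 2 : ℝ) : ℂ)‖ :=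
        norm_le_norm_sub_add _ _
    _ ≤ κ * (C * ‖u‖ ^ 2) + |γ| * ‖j u‖ ^ 2 := by
        rw [Complex.norm_real, norm_mul, Real.norm_eq_abs, norm_pow, norm_norm]
        gcongr
        exact (hsec u).trans (by gcongr)
    _ ≤ κ * (C * ‖u‖ ^ 2) + |γ| * (‖j‖ * ‖u‖) ^ 2 := by
        gcongr
        exact j.le_opNorm u
    _ = (κ * C + |γ| * ‖j‖ ^ 2) * ‖u‖ ^ 2 := by ring

end ClosedForms

theorem tendsto_infDist_of_monotone_of_dense {ι X : Type*} [Preorder ι] [PseudoMetricSpace X]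
    {s : ι → Set X} (hs : Monotone s) (hdense : Dense (⋃ i, s i)) (x : X) :
    Tendsto (fun i => Metric.infDist x (s i)) atTop (𝓝 0) := by
  refine tendsto_order.2 ⟨fun ε hε =>
    .of_forall fun i => hε.trans_le Metric.infDist_nonneg, fun ε hε => ?_⟩
  obtain ⟨y, hy, hxy⟩ := hdense.exists_dist_lt x hε
  obtain ⟨n, hn⟩ := Set.mem_iUnion.1 hy
  filter_upwards [eventually_ge_atTop n] with i hi
  exact (Metric.infDist_le_dist_of_mem (hs hi hn)).trans_lt hxy

theorem tendsto_iSup_enorm_sub_of_isSemigroupGeneratedByNeg {X : Type*} [NormedAddCommGroup X]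
    [NormedSpace ℂ X] [CompleteSpace X] {ι : Type*} {p : Filter ι} {A : Submodule ℂ (X × X)}
    {B : ι → Submodule ℂ (X × X)} {U S : ℝ → X →L[ℂ] X} {U' S' : ι → ℝ → X →L[ℂ] X} {w r : ℝ}
    {f : X}
    (hU : IsSemigroupGeneratedByNeg A fun t => Real.exp (w * t) • U t)
    (hU' : ∀ i, IsSemigroupGeneratedByNeg (B i) fun t => Real.exp (w * t) • U' i t)
    (h : TendstoUniformlyOn (fun i t => U' i t f) (fun t => U t f) p (Set.Ioc 0 r))
    (hS : IsSemigroupGeneratedByNeg A S) (hS' : ∀ i, IsSemigroupGeneratedByNeg (B i) (S' i)) :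
    Tendsto (fun i => ⨆ t ∈ Set.Ioc 0 r, ‖(S' i t - S t) f‖ₑ) p (𝓝 0) := by
  have hexp : ∀ t ∈ Set.Ioc 0 r, ‖Real.exp (w * t)‖ ≤ Real.exp (|w| * r) := by
    intro t ht
    rw [Real.norm_of_nonneg (Real.exp_nonneg _), Real.exp_le_exp]
    exact mul_le_mul (le_abs_self w) ht.2 ht.1.le (abs_nonneg w)
  refine tendsto_iSup_enorm_sub_of_tendstoUniformlyOn
    (((tendstoUniformlyOn_smul_of_norm_le hexp h).congr (.of_forall fun i t ht => ?_)).congr_right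
      fun t ht => ?_)
  · exact congrArg (· f) ((hU' i).eqOn (hS' i) ht.1)
  · exact congrArg (· f) (hU.eqOn hS ht.1)

section FormConvergence

variable {V : Type*} [NormedAddCommGroup V] [InnerProductSpace ℂ V] [CompleteSpace V]
  {H : Type*} [NormedAddCommGroup H] [InnerProductSpace ℂ H] [CompleteSpace H]
  {j : V →L[ℂ] H} {a : V →ₗ[ℂ] V →ₗ⋆[ℂ] ℂ}

theorem IsEllipticForm.exists_isCoerciveWith (ha : IsEllipticForm j a) :
    ∃ (w α : ℝ) (L : V →L[ℂ] V), IsCoerciveWith α L ∧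
      ∀ u v, inner ℂ v (L u) = a u v + w * inner ℂ (j v) (j u) := by
  obtain ⟨M, hM⟩ := ha.bounded
  obtain ⟨w, α, hα, hcoercive⟩ := ha.elliptic
  obtain ⟨L, hL⟩ := exists_inner_eq_sesquilinear hM
  refine ⟨w, α, shiftedOperator j L w, ⟨hα, fun u => ?_⟩, fun u v => ?_⟩
  · rw [re_inner_shiftedOperator, hL]
    exact hcoercive u
  · rw [inner_shiftedOperator, hL]

theorem theorem3p7_general (ha : IsEllipticForm j a) {ι : Type*} {p : Filter ι}
    {W : ι → Submodule ℂ V} (hW_closed : ∀ i, IsClosed (W i : Set V))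
    (hW : ∀ u, Tendsto (fun i => Metric.infDist u (W i : Set V)) p (𝓝 0)) :
    (∃ S, IsSemigroupGeneratedByNeg (associatedGraph (j : V →ₗ[ℂ] H) a) S) ∧
    (∀ i, ∃ S, IsSemigroupGeneratedByNeg
      (associatedGraph ((j : V →ₗ[ℂ] H).comp (W i).subtype) (restrictForm a (W i))) S) ∧
    ∀ (S : ℝ → H →L[ℂ] H) (S' : ι → ℝ → H →L[ℂ] H),
      IsSemigroupGeneratedByNeg (associatedGraph (j : V →ₗ[ℂ] H) a) S →
      (∀ i, IsSemigroupGeneratedByNeg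
        (associatedGraph ((j : V →ₗ[ℂ] H).comp (W i).subtype) (restrictForm a (W i))) (S' i)) →
      ∀ (r : ℝ) (f : H), Tendsto (fun i => ⨆ t ∈ Set.Ioc 0 r, ‖(S' i t - S t) f‖ₑ) p (𝓝 0) := by
  have hcomplete : ∀ i, CompleteSpace (W i) := fun i => (hW_closed i).completeSpace_coe
  obtain ⟨w, α, L, hL, hLa⟩ := ha.exists_isCoerciveWith
  have hQ := hL.isContractivePseudoresolvent_formResolvent (j := j)
  have hdense := hL.dense_range_formResolvent_sup_ker (j := j) zero_le_one
  have hQ' i := (hL.compression (W i)).isContractivePseudoresolvent_formResolvent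
    (j := j ∘L (W i).subtypeL)
  obtain ⟨U, hU⟩ := hQ.exists_isYosidaLimit one_pos hdense
  choose U' hU' using fun i => (hQ' i).exists_isYosidaLimit one_pos
    ((hL.compression (W i)).dense_range_formResolvent_sup_ker zero_le_one)
  have hgen := hL.isSemigroupGeneratedByNeg_associatedGraph hLa hU
  have hgen' i : IsSemigroupGeneratedByNeg
      (associatedGraph ((j : V →ₗ[ℂ] H).comp (W i).subtype) (restrictForm a (W i)))
      fun t => Real.exp (w * t) • U' i t :=
    (hL.compression (W i)).isSemigroupGeneratedByNeg_associatedGraph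
      (fun u v => (inner_compression L (W i) u v).trans (hLa u v)) (hU' i)
  refine ⟨⟨_, hgen⟩, fun i => ⟨_, hgen' i⟩, fun S S' hS hS' r f => ?_⟩
  have hconv := hU.tendstoUniformlyOn hQ hU' hQ'
    (fun l hl => hL.tendsto_formResolvent_compression hl.le hW) one_pos hdense
    (fun i _ hx => hL.formResolvent_compression_eq_zero zero_le_one (W i) hx) f r
  exact tendsto_iSup_enorm_sub_of_isSemigroupGeneratedByNeg hgen hgen' hconv hS hS'

end FormConvergence

theorem theorem3p7
    {V : Type*} [NormedAddCommGroup V] [InnerProductSpace ℂ V] [CompleteSpace V]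
    {H : Type*} [NormedAddCommGroup H] [InnerProductSpace ℂ H] [CompleteSpace H]
    (j : V →L[ℂ] H) (hj : Function.Injective j)
    (a : V →ₗ[ℂ] V →ₗ⋆[ℂ] ℂ)
    (ha_sectorial : IsSectorialForm (j : V →ₗ[ℂ] H) a)
    (ha_closed : IsClosedForm (j : V →ₗ[ℂ] H) a)
    (Vn : ℕ → Submodule ℂ V) (hVn_mono : Monotone Vn)
    (hVn_closed : ∀ n, IsClosed (Vn n : Set V))
    (hVn_dense : Dense (⋃ n, (Vn n : Set V)))
    (A : Submodule ℂ (H × H)) (hA : A = associatedGraph (j : V →ₗ[ℂ] H) a)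
    (An : ℕ → Submodule ℂ (H × H))
    (hAn : ∀ n, An n =
      associatedGraph ((j : V →ₗ[ℂ] H).comp (Vn n).subtype) (restrictForm a (Vn n))) :
    -- the semigroups exist
    (∃ S : ℝ → H →L[ℂ] H, IsSemigroupGeneratedByNeg A S) ∧
    (∀ n, ∃ S : ℝ → H →L[ℂ] H, IsSemigroupGeneratedByNeg (An n) S) ∧
    -- and they converge strongly, uniformly on bounded time intervals
    (∀ (S : ℝ → H →L[ℂ] H) (Sn : ℕ → ℝ → H →L[ℂ] H),
      IsSemigroupGeneratedByNeg A S →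
      (∀ n, IsSemigroupGeneratedByNeg (An n) (Sn n)) →
      ∀ T : ℝ, 0 < T → ∀ f : H,
        Tendsto (fun n => ⨆ t ∈ Set.Ioc 0 T, ‖(Sn n t - S t) f‖ₑ) atTop (𝓝 0)) := by
  subst hA
  obtain rfl := funext hAn
  obtain ⟨hS, hSn, hlim⟩ := theorem3p7_general (ha_closed.isEllipticForm hj) hVn_closed
    (tendsto_infDist_of_monotone_of_dense hVn_mono hVn_dense)
  exact ⟨hS, hSn, fun S Sn hS hSn T _ f => hlim S Sn hS hSn T f⟩
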